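/- **Conventions.** For a domain $R$ of characteristic $\neq 2$ with fraction field $K$, an $n$-ary quadratic form $f_{/R}$ is a homogeneous polynomial $f \in R[t_1,\ldots,t_n]$ of degree $2$ (arbitrary coefficients in $R$) that is nondegenerate, i.e. whose polar bilinear form $f(x+y)-f(x)-f(y)$ is nondegenerate. For a ring extension $A$ of $R$, $f_{/A}$ is the same polynomial viewed over $A$, and $\cong$ means equivalence under an invertible linear change of variables over the base ring. The form $f_{/R}$ is isotropic if $f(v)=0$ for some nonzero $v \in R^n$, and anisotropic otherwise; it is universal if it represents (takes as a value on $R^n$) every nonzero element of $R$; it is maximal if there is no $R$-lattice $M \supsetneq R^n$ in $K^n$ on which $f$ takes values in $R$. A form $f_{/\mathbb{R}}$ has signature $(r,s)$ if $f \cong x_1^2+\cdots+x_r^2-x_{r+1}^2-\cdots-x_{r+s}^2$. **Theorem 5.1 (Globalization).** Let $n,r,s \in \mathbb{N} = \{0,1,2,\ldots\}$ with $n \geq 3$ and $r+s=n$. Let $S$ be a finite set of prime numbers and let $T \subseteq S$. If $n=3$, suppose that $\#T$ is odd if $rs=0$ and even otherwise. For each $p \in S$, let $f_p$ be an $n$-ary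 (nondegenerate) quadratic form over $\mathbb{Z}_p$ that is anisotropic if and only if $p \in T$. Then there is an $n$-ary (nondegenerate) quadratic form $f_{/\mathbb{Z}}$ such that: * for all $p \in S$, we have $f_{/\mathbb{Z}_p} \cong f_p$; * the form $f_{/\mathbb{R}}$ has signature $(r,s)$; * if $n=3$, then for all primes $p \notin S$, the form $f_{/\mathbb{Z}_p}$ is isotropic, maximal and universal; * if $n \geq 4$, then for all primes $p \notin S$, the form $f_{/\mathbb{Z}_p}$ is universal. -/

import Mathlib

open scoped BigOperators

namespace IntegralForms

noncomputable section

/-- Extension of scalars of an `n`-ary quadratic form `f` over `R` to an `R`-algebra `A`: the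
quadratic form on `Aⁿ` with the same coefficients, i.e. for
`f = ∑ aᵢ tᵢ² + ∑_{i<j} bᵢⱼ tᵢ tⱼ` (so `aᵢ = f(eᵢ)` and `bᵢⱼ = f(eᵢ + eⱼ) - f(eᵢ) - f(eⱼ)`) the form
given by the same polynomial with its coefficients mapped to `A`. (Mathlib's
`QuadraticForm.baseChange` requires `2` to be invertible in `R`.) -/
def extend {R : Type*} [CommRing R] (A : Type*) [CommRing A] [Algebra R A] {n : ℕ}
    (f : QuadraticForm R (Fin n → R)) : QuadraticForm A (Fin n → A) :=
  ∑ i, algebraMap R A (f (Pi.single i 1)) • QuadraticMap.proj i i +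
    ∑ i, ∑ j ∈ Finset.Ioi i,
      algebraMap R A (QuadraticMap.polar f (Pi.single i 1) (Pi.single j 1)) •
        QuadraticMap.proj i j

/-- A quadratic form over a domain of characteristic different from `2` is nondegenerate if its
polar bilinear form `f(x + y) - f(x) - f(y)` is. -/
def IsNondegenerate {R : Type*} [CommRing R] {n : ℕ} (f : QuadraticForm R (Fin n → R)) : Prop :=
  f.polarBilin.Nondegenerate

/-- `f` has a nontrivial zero, i.e. it is not anisotropic. -/
def IsIsotropic {R : Type*} [CommRing R] {n : ℕ} (f : QuadraticForm R (Fin n → R)) : Prop :=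
  ∃ v : Fin n → R, v ≠ 0 ∧ f v = 0

/-- `f` represents every nonzero element of `R`. -/
def IsUniversal {R : Type*} [CommRing R] {n : ℕ} (f : QuadraticForm R (Fin n → R)) : Prop :=
  ∀ a : R, a ≠ 0 → ∃ v : Fin n → R, f v = a

/-- The standard lattice: the image of `Rⁿ` in `Kⁿ`. -/
def stdLattice (R : Type*) [CommRing R] (K : Type*) [Field K] [Algebra R K] (n : ℕ) :
    Submodule R (Fin n → K) :=
  LinearMap.range ((Algebra.linearMap R K).compLeft (Fin n))

/-- For `K` the fraction field of `R`, the form `f` is maximal if no `R`-lattice of `Kⁿ` on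
which `f` takes values in `R` strictly contains `Rⁿ`. -/
def IsMaximal {R : Type*} [CommRing R] (K : Type*) [Field K] [Algebra R K] [IsFractionRing R K]
    {n : ℕ} (f : QuadraticForm R (Fin n → R)) : Prop :=
  ¬ ∃ M : Submodule R (Fin n → K), Submodule.IsLattice K M ∧ stdLattice R K n < M ∧
    ∀ x ∈ M, extend K f x ∈ Set.range (algebraMap R K)

/-- A real `n`-ary quadratic form has signature `(r, s)`, where `r + s = n`, if it is isometric to
`x₁² + ⋯ + xᵣ² - xᵣ₊₁² - ⋯ - xᵣ₊ₛ²`. -/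
def HasSignature {n : ℕ} (f : QuadraticForm ℝ (Fin n → ℝ)) (r s : ℕ) : Prop :=
  r + s = n ∧ QuadraticMap.Equivalent f
    (QuadraticMap.weightedSumSquares ℝ (fun i : Fin n => if (i : ℕ) < r then (1 : ℝ) else -1))

end

end IntegralForms

/-! A form over a domain of characteristic zero is determined by the Gram matrix of its polar form,
and the matrices that arise are the symmetric ones with even diagonal. So the task is to find such
an integral matrix `A`.

Over `ℤ_p`, forms close enough to a nondegenerate form are equivalent to it
(`exists_pow_dvd_imp_equivalent`, by the inverse function theorem). The conditions at `S` therefore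
become congruences on `A`. The prime 2 is always added to `S`, with the model form `xy + z² + ⋯` if
nothing is prescribed there.

The core is `exists_approximation`, which builds `A` by bordering, one row and column at a time. The
determinant of a bordered matrix is affine in the corner entry, so Dirichlet's theorem makes it a
fixed gcd times a new prime of either sign. The sign gives the signature. A good choice of the
border keeps primes outside `S` out of the gcd, so outside `S` at most one prime `l` divides the
determinant, and `l²` does not.

When `p²` does not divide the determinant, the form is maximal at `p`, and it is universal as soon
as it is isotropic; both follow from `sq_dvd_det_of_primitive`. It remains to prove isotropy outside
`S`. At `p ≠ l` the form is unimodular, and Chevalley–Warning with Hensel's lemma suffices. At `l`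
the reduction has rank at least `n - 1`, so the same argument works if `n ≥ 4`. If `n = 3`, isotropy
at a place is the triviality of a Hilbert symbol, and reciprocity with the parity of `T` forces it
at `l`. Reciprocity (`prod_hilbert`) is deduced from quadratic reciprocity, and the symbol is
matched with solvability of conics in `hasConicPoint_padic_iff`. -/

namespace IntegralForms

open Matrix

/-! ### Gram matrices, equivalence and extension of scalars -/

section Gram

variable {R : Type*} [CommRing R] {n : ℕ}

/-- The matrix of the polar bilinear form in the standard basis. -/
def gram (f : QuadraticForm R (Fin n → R)) : Matrix (Fin n) (Fin n) R :=
  Matrix.of fun i j => QuadraticMap.polar f (Pi.single i 1) (Pi.single j 1)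

theorem gram_eq_toMatrix (f : QuadraticForm R (Fin n → R)) :
    gram f = LinearMap.toMatrix₂' R f.polarBilin := by
  ext i j
  simp [gram, LinearMap.toMatrix₂'_apply]

theorem polar_eq_dotProduct (f : QuadraticForm R (Fin n → R)) (x y : Fin n → R) :
    QuadraticMap.polar f x y = x ⬝ᵥ gram f *ᵥ y := by
  rw [gram_eq_toMatrix, ← Matrix.toLinearMap₂'_apply', Matrix.toLinearMap₂'_toMatrix',
    QuadraticMap.polarBilin_apply_apply]

theorem two_mul_apply (f : QuadraticForm R (Fin n → R)) (x : Fin n → R) :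
    2 * f x = x ⬝ᵥ gram f *ᵥ x := by
  rw [← polar_eq_dotProduct, QuadraticMap.polar_self, two_nsmul, two_mul]

theorem gram_symm (f : QuadraticForm R (Fin n → R)) : (gram f)ᵀ = gram f := by
  ext i j
  simp [gram, QuadraticMap.polar_comm]

theorem gram_diag (f : QuadraticForm R (Fin n → R)) (i : Fin n) :
    gram f i i = 2 * f (Pi.single i 1) := by
  simp [gram, QuadraticMap.polar_self]

theorem isNondegenerate_iff [IsDomain R] (f : QuadraticForm R (Fin n → R)) :
    IsNondegenerate f ↔ (gram f).det ≠ 0 := by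
  unfold IsNondegenerate
  rw [LinearMap.nondegenerate_iff_det_ne_zero (Pi.basisFun R (Fin n))]
  have : LinearMap.toMatrix₂ (Pi.basisFun R (Fin n)) (Pi.basisFun R (Fin n)) f.polarBilin
      = gram f := by
    ext i j
    simp [gram, LinearMap.toMatrix₂_apply]
  rw [this]

theorem dotProduct_mulVec_conj (A P : Matrix (Fin n) (Fin n) R) (x y : Fin n → R) :
    (P *ᵥ x) ⬝ᵥ A *ᵥ (P *ᵥ y) = x ⬝ᵥ (Pᵀ * A * P) *ᵥ y := by
  rw [dotProduct_comm, ← Matrix.mulVec_mulVec, ← Matrix.mulVec_mulVec,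
    Matrix.dotProduct_mulVec x, Matrix.vecMul_transpose, dotProduct_comm]

theorem eq_of_two_mul_dotProduct [IsDomain R] [CharZero R] {f : QuadraticForm R (Fin n → R)}
    {A : Matrix (Fin n) (Fin n) R} (hA : Aᵀ = A) (h : ∀ x, 2 * f x = x ⬝ᵥ A *ᵥ x) :
    gram f = A := by
  have h2 : (2 : R) ≠ 0 := two_ne_zero
  ext i j
  apply mul_left_cancel₀ h2
  simp only [gram, Matrix.of_apply, QuadraticMap.polar, mul_sub, h, Matrix.mulVec_add,
    dotProduct_add, add_dotProduct]
  have : A j i = A i j := by conv_rhs => rw [← hA, Matrix.transpose_apply]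
  simp [this]
  ring

theorem gram_injective [IsDomain R] [CharZero R] {f g : QuadraticForm R (Fin n → R)}
    (h : gram f = gram g) : f = g := by
  ext x
  apply mul_left_cancel₀ (two_ne_zero (α := R))
  rw [two_mul_apply, two_mul_apply, h]

/-- Evenness of the diagonal lets `A` be written as `U + Uᵀ` with `U` upper triangular, without
dividing by 2; the form is then `xᵀ U x`. -/
theorem exists_gram_eq [IsDomain R] [CharZero R] {A : Matrix (Fin n) (Fin n) R} (hA : Aᵀ = A)
    (hd : ∀ i, 2 ∣ A i i) : ∃ f : QuadraticForm R (Fin n → R), gram f = A := by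
  choose c hc using hd
  let U : Matrix (Fin n) (Fin n) R :=
    Matrix.of fun i j => if i < j then A i j else if i = j then c i else 0
  have hU : U + Uᵀ = A := by
    ext i j
    have hs : A j i = A i j := by conv_rhs => rw [← hA, Matrix.transpose_apply]
    rcases lt_trichotomy i j with h | h | h
    · simp [U, h, h.not_gt, h.ne']
    · subst h; simp [U, hc]; ring
    · simp [U, h, h.not_gt, h.ne', hs]
  refine ⟨LinearMap.BilinMap.toQuadraticMap (Matrix.toBilin' U), eq_of_two_mul_dotProduct hA fun x => ?_⟩
  rw [LinearMap.BilinMap.toQuadraticMap_apply, Matrix.toBilin'_apply', ← hU, Matrix.add_mulVec,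
    dotProduct_add, Matrix.mulVec_transpose, dotProduct_comm x (x ᵥ* U), ← Matrix.dotProduct_mulVec,
    two_mul]

theorem equivalent_of_gram_eq [IsDomain R] [CharZero R] {f g : QuadraticForm R (Fin n → R)}
    {P : Matrix (Fin n) (Fin n) R} (hP : IsUnit P.det) (h : gram g = Pᵀ * gram f * P) :
    QuadraticMap.Equivalent g f := by
  have := P.invertibleOfIsUnitDet hP
  refine ⟨⟨Matrix.toLin'OfInv (invOf_mul_self P) (mul_invOf_self P), fun x => ?_⟩⟩
  apply mul_left_cancel₀ (two_ne_zero (α := R))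
  change 2 * f (Matrix.toLin' P x) = 2 * g x
  rw [Matrix.toLin'_apply, two_mul_apply, two_mul_apply, h, dotProduct_mulVec_conj]

theorem exists_gram_eq_of_equivalent [IsDomain R] [CharZero R] {f g : QuadraticForm R (Fin n → R)}
    (h : QuadraticMap.Equivalent g f) :
    ∃ P : Matrix (Fin n) (Fin n) R, IsUnit P.det ∧ gram g = Pᵀ * gram f * P := by
  obtain ⟨e⟩ := h
  refine ⟨LinearMap.toMatrix' (e.toLinearEquiv : (Fin n → R) →ₗ[R] (Fin n → R)), ?_, ?_⟩
  · rw [LinearMap.det_toMatrix']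
    exact LinearEquiv.isUnit_det' _
  · refine eq_of_two_mul_dotProduct ?_ fun x => ?_
    · simp [Matrix.transpose_mul, gram_symm, Matrix.mul_assoc]
    · rw [← dotProduct_mulVec_conj, LinearMap.toMatrix'_mulVec, ← two_mul_apply]
      exact congrArg _ (e.map_app x).symm

theorem extend_apply (A : Type*) [CommRing A] [Algebra R A] (f : QuadraticForm R (Fin n → R))
    (x : Fin n → A) :
    extend A f x = ∑ i, algebraMap R A (f (Pi.single i 1)) * (x i * x i) +
      ∑ i, ∑ j ∈ Finset.Ioi i, algebraMap R A (gram f i j) * (x i * x j) := by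
  simp [extend, gram, Algebra.smul_def]

/-- The symmetric double sum splits into its diagonal and two equal triangles. This is what allows
`extend` to be handled through Gram matrices alone. -/
theorem two_mul_extend_apply (A : Type*) [CommRing A] [Algebra R A]
    (f : QuadraticForm R (Fin n → R)) (x : Fin n → A) :
    2 * extend A f x = x ⬝ᵥ (gram f).map (algebraMap R A) *ᵥ x := by
  have key : x ⬝ᵥ (gram f).map (algebraMap R A) *ᵥ x =
      ∑ i, ∑ j, algebraMap R A (gram f i j) * (x i * x j) := by
    simp only [dotProduct, Matrix.mulVec, Finset.mul_sum, Matrix.map_apply]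
    exact Finset.sum_congr rfl fun i _ => Finset.sum_congr rfl fun j _ => by ring
  set t : Fin n → Fin n → A := fun i j => algebraMap R A (gram f i j) * (x i * x j) with ht
  have hts : ∀ i j, t i j = t j i := fun i j => by
    have : gram f i j = gram f j i := by conv_lhs => rw [← gram_symm, Matrix.transpose_apply]
    simp [ht, this, mul_comm]
  have split : ∀ i, ∑ j, t i j = t i i + ∑ j ∈ Finset.Ioi i, t i j + ∑ j ∈ Finset.Iio i, t i j := by
    intro i
    have h1 : (Finset.univ : Finset (Fin n)) = Finset.Iio i ∪ Finset.Ici i := by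
      ext j; simp [lt_or_ge]
    have h2 : Disjoint (Finset.Iio i) (Finset.Ici i) := by
      rw [Finset.disjoint_left]; intro j; simp
    rw [h1, Finset.sum_union h2, ← Finset.Ioi_insert, Finset.sum_insert (by simp)]
    ring
  have swap : ∑ i, ∑ j ∈ Finset.Iio i, t i j = ∑ i, ∑ j ∈ Finset.Ioi i, t i j := by
    rw [Finset.sum_comm' (t' := Finset.univ) (s' := fun j => Finset.Ioi j) (by simp)]
    exact Finset.sum_congr rfl fun i _ => Finset.sum_congr rfl fun j _ => hts _ _
  rw [key, extend_apply, Finset.sum_congr rfl fun i _ => split i, Finset.sum_add_distrib,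
    Finset.sum_add_distrib, swap]
  simp only [ht, gram_diag, map_mul, map_ofNat]
  rw [mul_add, Finset.mul_sum]
  simp only [mul_assoc]
  ring

theorem gram_extend (A : Type*) [CommRing A] [IsDomain A] [CharZero A] [Algebra R A]
    (f : QuadraticForm R (Fin n → R)) : gram (extend A f) = (gram f).map (algebraMap R A) :=
  eq_of_two_mul_dotProduct (by rw [← Matrix.transpose_map, gram_symm]) (two_mul_extend_apply A f)

theorem extend_algebraMap (A : Type*) [CommRing A] [IsDomain A] [CharZero A] [Algebra R A]
    (f : QuadraticForm R (Fin n → R)) (v : Fin n → R) :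
    extend A f (fun i => algebraMap R A (v i)) = algebraMap R A (f v) := by
  apply mul_left_cancel₀ (two_ne_zero (α := A))
  rw [two_mul_extend_apply]
  have : algebraMap R A 2 = 2 := map_ofNat _ _
  rw [← this, ← map_mul, two_mul_apply]
  simp [dotProduct, Matrix.mulVec]

theorem extend_extend (A B : Type*) [CommRing A] [IsDomain A] [CharZero A] [Algebra R A]
    [CommRing B] [IsDomain B] [CharZero B] [Algebra R B] [Algebra A B] [IsScalarTower R A B]
    (f : QuadraticForm R (Fin n → R)) : extend B (extend A f) = extend B f := by
  apply gram_injective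
  rw [gram_extend, gram_extend, gram_extend, Matrix.map_map, IsScalarTower.algebraMap_eq R A B]
  rfl

theorem equivalent_extend [IsDomain R] [CharZero R] (A : Type*) [CommRing A] [IsDomain A]
    [CharZero A] [Algebra R A] {f g : QuadraticForm R (Fin n → R)}
    (h : QuadraticMap.Equivalent g f) : QuadraticMap.Equivalent (extend A g) (extend A f) := by
  obtain ⟨P, hP, h⟩ := exists_gram_eq_of_equivalent h
  refine equivalent_of_gram_eq (P := P.map (algebraMap R A)) ?_ ?_
  · have := hP.map (algebraMap R A)
    rwa [RingHom.map_det] at this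
  · rw [gram_extend, gram_extend, h, Matrix.map_mul, Matrix.map_mul, Matrix.transpose_map]

theorem IsIsotropic.of_equivalent {f g : QuadraticForm R (Fin n → R)}
    (h : QuadraticMap.Equivalent f g) (hf : IsIsotropic f) : IsIsotropic g := by
  obtain ⟨e⟩ := h
  obtain ⟨v, hv, h0⟩ := hf
  exact ⟨e v, fun h => hv (by simpa using h), by rw [e.map_app, h0]⟩

theorem IsUniversal.of_equivalent {f g : QuadraticForm R (Fin n → R)}
    (h : QuadraticMap.Equivalent f g) (hf : IsUniversal f) : IsUniversal g := by
  obtain ⟨e⟩ := h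
  intro a ha
  obtain ⟨v, hv⟩ := hf a ha
  exact ⟨e v, by rw [e.map_app, hv]⟩

theorem isIsotropic_iff_not_anisotropic (f : QuadraticForm R (Fin n → R)) :
    IsIsotropic f ↔ ¬ f.Anisotropic := by
  simp only [IsIsotropic, QuadraticMap.Anisotropic, not_forall]
  exact exists_congr fun v => by tauto

end Gram

end IntegralForms

namespace IntegralForms

open Matrix Filter Topology

/-! ### Congruence classes of invertible symmetric matrices are p-adically open -/

section Approximation

attribute [local instance] Matrix.linftyOpNormedRing Matrix.linftyOpNormedAlgebra

variable {p : ℕ} [Fact p.Prime] {n : ℕ}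

theorem exists_norm_le_imp_of_eventually {P : Matrix (Fin n) (Fin n) ℚ_[p] → Prop}
    (h : ∀ᶠ E in 𝓝 0, P E) :
    ∃ N : ℕ, ∀ E : Matrix (Fin n) (Fin n) ℚ_[p],
      (∀ i j, ‖E i j‖ ≤ (p : ℝ) ^ (-(N : ℤ))) → P E := by
  obtain ⟨ε, hε, hP⟩ := Metric.eventually_nhds_iff.mp h
  have hp1 : (1 : ℝ) < p := mod_cast (Fact.out : p.Prime).one_lt
  -- The operator norm is the largest row sum, at most `n * p ^ (-N)`; `n + 1` avoids division by
  -- zero when `n = 0`.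
  obtain ⟨N, hN⟩ := exists_pow_lt_of_lt_one (show 0 < ε / (n + 1) by positivity)
    (inv_lt_one_of_one_lt₀ hp1)
  refine ⟨N, fun E hE => hP ?_⟩
  rw [dist_zero_right, Matrix.linfty_opNorm_def]
  have : (Finset.univ.sup fun i => ∑ j, ‖E i j‖₊) ≤ (n : NNReal) * (p : NNReal)⁻¹ ^ N := by
    refine Finset.sup_le fun i _ => (Finset.sum_le_card_nsmul _ _ ((p : NNReal)⁻¹ ^ N) ?_).trans
      (by rw [Finset.card_univ, Fintype.card_fin, nsmul_eq_mul])
    intro j _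
    have := hE i j
    rw [_root_.zpow_neg, zpow_natCast, ← inv_pow] at this
    rw [← NNReal.coe_le_coe]
    simpa using this
  calc _ ≤ (n : ℝ) * (p : ℝ)⁻¹ ^ N := by exact_mod_cast this
    _ ≤ (n + 1) * (p : ℝ)⁻¹ ^ N := by gcongr; linarith
    _ < (n + 1) * (ε / (n + 1)) := by gcongr
    _ = ε := by field_simp

/-- Near `0` in a complete normed algebra with a continuous anti-automorphism `τ`, the equation
`Y + Y C Y = E` with `C` and `E` fixed by `τ` has a small solution `Y` fixed by `τ`. -/
theorem eventually_exists_add_mul_mul_eq {K 𝔸 : Type*} [NontriviallyNormedField K] [NormedRing 𝔸]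
    [NormedAlgebra K 𝔸] [CompleteSpace 𝔸] {τ : 𝔸 → 𝔸} (hτ : Continuous τ) (hτ0 : τ 0 = 0)
    (hadd : ∀ a b, τ (a + b) = τ a + τ b) (hmul : ∀ a b, τ (a * b) = τ b * τ a) {C : 𝔸}
    (hC : τ C = C) {U : Set 𝔸} (hU : U ∈ 𝓝 0) :
    ∀ᶠ E in 𝓝 (0 : 𝔸), τ E = E → ∃ Y ∈ U, τ Y = Y ∧ Y + Y * C * Y = E := by
  set ψ : 𝔸 → 𝔸 := fun Y => Y + Y * C * Y with hψ
  have hψ0 : ψ 0 = 0 := by simp [ψ]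
  have hd : HasStrictFDerivAt ψ ((ContinuousLinearEquiv.refl K 𝔸 : 𝔸 ≃L[K] 𝔸) : 𝔸 →L[K] 𝔸) 0 := by
    have h1 : HasStrictFDerivAt (fun Y : 𝔸 => Y) (ContinuousLinearMap.id K 𝔸) 0 :=
      hasStrictFDerivAt_id 0
    refine (h1.add ((h1.mul_const' C).mul' h1)).congr_fderiv ?_
    ext Y
    simp
  have hinv : Tendsto (hd.localInverse ψ _ 0) (𝓝 0) (𝓝 0) := by
    have := hd.localInverse_tendsto
    rwa [hψ0] at this
  have e1 : ∀ᶠ E in 𝓝 (0 : 𝔸), ψ (hd.localInverse ψ _ 0 E) = E := by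
    have := hd.eventually_right_inverse
    rwa [hψ0] at this
  have ht : Tendsto τ (𝓝 0) (𝓝 0) := by simpa [hτ0] using hτ.tendsto 0
  have e2 := (ht.comp hinv).eventually hd.eventually_left_inverse
  filter_upwards [e1, e2, hinv hU] with E h1 h2 h3 hE
  refine ⟨_, h3, ?_, h1⟩
  -- `τ Y` solves the same equation as `Y` and is also close to 0, where `ψ` is injective; hence `τ
  -- Y = Y`.
  have : ψ (τ (hd.localInverse ψ _ 0 E)) = E := by
    conv_rhs => rw [← hE, ← h1]
    simp [ψ, hadd, hmul, hC, mul_assoc]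
  rw [Function.comp_apply, this] at h2
  exact h2.symm

/-- Symmetric matrices close to an invertible symmetric `p`-adic matrix are congruent to it by a
matrix close to the identity. -/
theorem eventually_exists_congruent {A : Matrix (Fin n) (Fin n) ℚ_[p]} (hA : Aᵀ = A)
    (hdet : IsUnit A.det) : ∀ᶠ E in 𝓝 (0 : Matrix (Fin n) (Fin n) ℚ_[p]), Eᵀ = E →
      ∃ X : Matrix (Fin n) (Fin n) ℚ_[p], (∀ i j, ‖X i j‖ < 1) ∧
        (1 + X)ᵀ * A * (1 + X) = A + E := by
  -- With `Y` symmetric and `X = ½ A⁻¹ Y`, the left side becomes `A + Y + ¼ Y A⁻¹ Y`, so the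
  -- equation to solve is that of the preceding lemma with `C = ¼ A⁻¹`.
  have hC : ((4⁻¹ : ℚ_[p]) • A⁻¹)ᵀ = (4⁻¹ : ℚ_[p]) • A⁻¹ := by
    simp [Matrix.transpose_nonsing_inv, hA]
  have hU : ∀ᶠ Y in 𝓝 (0 : Matrix (Fin n) (Fin n) ℚ_[p]),
      ∀ i j, ‖((2⁻¹ : ℚ_[p]) • (A⁻¹ * Y)) i j‖ < 1 := by
    simp only [eventually_all]
    intro i j
    have hc : Continuous fun Y : Matrix (Fin n) (Fin n) ℚ_[p] =>
        ‖((2⁻¹ : ℚ_[p]) • (A⁻¹ * Y)) i j‖ := by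
      have h1 : Continuous fun Y : Matrix (Fin n) (Fin n) ℚ_[p] => A⁻¹ * Y :=
        continuous_const.matrix_mul continuous_id
      exact ((h1.const_smul (2⁻¹ : ℚ_[p])).matrix_elem i j).norm
    refine (hc.tendsto 0).eventually_lt_const (u := 1) ?_
    simp
  have : @CompleteSpace (Matrix (Fin n) (Fin n) ℚ_[p]) PseudoMetricSpace.toUniformSpace :=
    inferInstanceAs (CompleteSpace (Fin n → Fin n → ℚ_[p]))
  filter_upwards [eventually_exists_add_mul_mul_eq (K := ℚ_[p])
    (continuous_id.matrix_transpose) Matrix.transpose_zero Matrix.transpose_add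
    Matrix.transpose_mul hC hU] with E h hE
  obtain ⟨Y, hYU, hYt, hY⟩ := h hE
  refine ⟨_, hYU, ?_⟩
  have hYt : Yᵀ = Y := hYt
  have hAA : A * A⁻¹ = 1 := Matrix.mul_nonsing_inv A hdet
  have hAA' : A⁻¹ * A = 1 := Matrix.nonsing_inv_mul A hdet
  have hE' : E = Y + (4⁻¹ : ℚ_[p]) • (Y * A⁻¹ * Y) := by
    rw [← hY]; simp
  rw [Matrix.transpose_add, Matrix.transpose_smul, Matrix.transpose_mul,
    Matrix.transpose_nonsing_inv, hA, hYt, Matrix.transpose_one, hE']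
  have t1 : (2⁻¹ : ℚ_[p]) • (Y * A⁻¹) * A = (2⁻¹ : ℚ_[p]) • Y := by
    rw [Matrix.smul_mul, Matrix.mul_assoc, hAA', Matrix.mul_one]
  rw [Matrix.add_mul, t1, Matrix.one_mul, Matrix.mul_add, Matrix.mul_one, Matrix.add_mul,
    Matrix.mul_smul, ← Matrix.mul_assoc, hAA, Matrix.one_mul, Matrix.smul_mul, Matrix.mul_smul,
    smul_smul, ← Matrix.mul_assoc]
  have : (2⁻¹ : ℚ_[p]) • Y + (2⁻¹ : ℚ_[p]) • Y = Y := by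
    rw [← add_smul]; norm_num
  have h4 : (2⁻¹ * 2⁻¹ : ℚ_[p]) = 4⁻¹ := by norm_num
  rw [h4]
  calc _ = A + ((2⁻¹ : ℚ_[p]) • Y + (2⁻¹ : ℚ_[p]) • Y) + (4⁻¹ : ℚ_[p]) • (Y * A⁻¹ * Y) := by abel
    _ = _ := by rw [this, add_assoc]

end Approximation

/-! ### Equivalence of nearby forms over `ℤ_p` -/

section Local

variable {p : ℕ} [Fact p.Prime] {n : ℕ}

/-- Modulo `p` the matrix is the identity, so its determinant reduces to 1. -/
theorem isUnit_det_one_add {X : Matrix (Fin n) (Fin n) ℤ_[p]} (hX : ∀ i j, ‖X i j‖ < 1) :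
    IsUnit (1 + X).det := by
  by_contra h
  have h1 : PadicInt.toZMod (1 + X).det = 0 := by
    rw [← RingHom.mem_ker, PadicInt.ker_toZMod]
    exact (IsLocalRing.mem_maximalIdeal _).2 h
  have h2 : (PadicInt.toZMod (p := p)).mapMatrix X = 0 := by
    ext i j
    rw [RingHom.mapMatrix_apply, Matrix.map_apply, Matrix.zero_apply, ← RingHom.mem_ker,
      PadicInt.ker_toZMod]
    exact (IsLocalRing.mem_maximalIdeal _).2 (PadicInt.mem_nonunits.2 (hX i j))
  rw [RingHom.map_det, map_add, map_one, h2, add_zero, Matrix.det_one] at h1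
  exact one_ne_zero h1

/-- Quadratic forms close to a nondegenerate form over `ℤ_p` are equivalent to it. -/
theorem exists_pow_dvd_imp_equivalent (f : QuadraticForm ℤ_[p] (Fin n → ℤ_[p]))
    (hf : IsNondegenerate f) : ∃ N : ℕ, ∀ g : QuadraticForm ℤ_[p] (Fin n → ℤ_[p]),
      (∀ i j, (p : ℤ_[p]) ^ N ∣ gram g i j - gram f i j) → QuadraticMap.Equivalent g f := by
  let φ : ℤ_[p] →+* ℚ_[p] := algebraMap ℤ_[p] ℚ_[p]
  have hφ : Function.Injective φ := IsFractionRing.injective ℤ_[p] ℚ_[p]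
  have hA : (φ.mapMatrix (gram f))ᵀ = φ.mapMatrix (gram f) := by
    rw [RingHom.mapMatrix_apply, ← Matrix.transpose_map, gram_symm]
  have hdet : IsUnit (φ.mapMatrix (gram f)).det := by
    rw [← RingHom.map_det, isUnit_iff_ne_zero]
    exact (map_ne_zero_iff φ hφ).2 ((isNondegenerate_iff f).1 hf)
  obtain ⟨N, hN⟩ := exists_norm_le_imp_of_eventually (eventually_exists_congruent hA hdet)
  refine ⟨N, fun g hg => ?_⟩
  obtain ⟨X, hX, hXA⟩ := hN (φ.mapMatrix (gram g - gram f)) (fun i j => by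
      have := (PadicInt.norm_le_pow_iff_mem_span_pow (gram g i j - gram f i j) N).2
        (Ideal.mem_span_singleton.2 (hg i j))
      simpa [φ, ← PadicInt.coe_sub] using this) (by
      rw [RingHom.mapMatrix_apply, ← Matrix.transpose_map, Matrix.transpose_sub, gram_symm,
        gram_symm])
  let X' : Matrix (Fin n) (Fin n) ℤ_[p] := Matrix.of fun i j => ⟨X i j, (hX i j).le⟩
  have hX' : φ.mapMatrix X' = X := by ext i j; rfl
  refine equivalent_of_gram_eq (isUnit_det_one_add (X := X') fun i j => hX i j) ?_
  have : Function.Injective (φ.mapMatrix (m := Fin n)) := fun a b h => by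
    ext i j
    exact hφ (congrFun (congrFun h i) j)
  apply this
  have ht : φ.mapMatrix (1 + X')ᵀ = (φ.mapMatrix (1 + X'))ᵀ := rfl
  rw [map_mul, map_mul, ht, map_add, map_one, hX', hXA, map_sub]
  abel

end Local

end IntegralForms

namespace IntegralForms

open Matrix

/-! ### Maximality and universality from a determinant not divisible by `p²` -/

section Maximal

/-- If a primitive vector `w` satisfies `A w ≡ 0` modulo `π` and `wᵀ A w ≡ 0` modulo `π ^ 2`, then
`π ^ 2` divides the determinant of the symmetric matrix `A`. -/
theorem sq_dvd_det_of_primitive {R : Type*} [CommRing R] {n : ℕ} {A : Matrix (Fin n) (Fin n) R}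
    (hA : Aᵀ = A) {w : Fin n → R} {j : Fin n} (hw : IsUnit (w j)) {π : R}
    (h1 : ∀ i, π ∣ (A *ᵥ w) i) (h2 : π ^ 2 ∣ w ⬝ᵥ A *ᵥ w) : π ^ 2 ∣ A.det := by
  choose u hu using h1
  obtain ⟨c, hc⟩ := h2
  -- Replace the basis vector `e_j` by `w`. This changes the determinant by the unit `(w j)²`, and
  -- the new Gram matrix `B` has row and column `j` divisible by `π` and corner divisible by `π²`.
  let E : Matrix (Fin n) (Fin n) R := (1 : Matrix (Fin n) (Fin n) R).updateCol j w
  have hE : E.det = w j := by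
    have := congrFun (congrFun (congrArg DFunLike.coe (Matrix.cramer_one (n := Fin n) (α := R))) w) j
    rw [Matrix.cramer_apply] at this
    exact this
  have hEj : E *ᵥ Pi.single j 1 = w := by
    ext i; simp [E]
  have hEi : ∀ i, i ≠ j → E *ᵥ Pi.single i 1 = Pi.single i 1 := by
    intro i hi
    ext k
    simp [E, Matrix.updateCol_ne hi, Matrix.one_apply, Pi.single_apply]
  set B := Eᵀ * A * E with hB
  have hBij : ∀ i k, B i k = (E *ᵥ Pi.single i 1) ⬝ᵥ A *ᵥ (E *ᵥ Pi.single k 1) := by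
    intro i k
    rw [dotProduct_mulVec_conj, ← hB]
    simp
  have hBs : ∀ i k, B i k = B k i := by
    intro i k
    have : Bᵀ = B := by simp [hB, Matrix.transpose_mul, hA, Matrix.mul_assoc]
    conv_lhs => rw [← this, Matrix.transpose_apply]
  have hBjj : B j j = π ^ 2 * c := by rw [hBij, hEj, hc]
  have hBi : ∀ i, i ≠ j → B i j = π * u i := by
    intro i hi
    rw [hBij, hEj, hEi i hi, ← hu i]
    simp
  -- One factor `π` comes out of column `j`; the corner keeps a second one, so another `π` comes out
  -- of row `j`.
  let c1 : Fin n → R := Function.update u j (π * c)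
  have e1 : B = B.updateCol j (π • c1) := by
    ext i k
    rcases eq_or_ne k j with rfl | hk
    · rcases eq_or_ne i k with rfl | hi
      · simp [c1, hBjj]; ring
      · simp [c1, hi, hBi i hi]
    · simp [hk]
  let B1 := B.updateCol j c1
  have e2 : B1 = B1.updateRow j (π • Function.update u j c) := by
    ext i k
    rcases eq_or_ne i j with rfl | hi
    · rcases eq_or_ne k i with rfl | hk
      · simp [B1, c1]
      · simp [B1, hk, hBs i k, hBi k hk]
    · simp [hi]
  have hdet : B.det = π ^ 2 * (B1.updateRow j (Function.update u j c)).det := by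
    rw [e1, Matrix.det_updateCol_smul]
    change π * B1.det = _
    conv_lhs => rw [e2, Matrix.det_updateRow_smul]
    ring
  have hdet2 : B.det = (w j * w j) * A.det := by
    rw [hB, Matrix.det_mul, Matrix.det_mul, Matrix.det_transpose, hE]; ring
  rw [← (hw.mul hw).dvd_mul_left, ← hdet2, hdet]
  exact dvd_mul_right _ _

variable {p : ℕ} [Fact p.Prime] {n : ℕ}

/-- Divide by a coordinate of largest norm. -/
theorem exists_primitive {v : Fin n → ℚ_[p]} (hv : v ≠ 0) :
    ∃ (w : Fin n → ℤ_[p]) (j : Fin n), v j ≠ 0 ∧ w j = 1 ∧ (∀ i, ‖v i‖ ≤ ‖v j‖) ∧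
      ∀ i, (w i : ℚ_[p]) = (v j)⁻¹ * v i := by
  obtain ⟨i0, hi0⟩ := Function.ne_iff.1 hv
  have : Nonempty (Fin n) := ⟨i0⟩
  obtain ⟨j, hj⟩ := Finite.exists_max fun i => ‖v i‖
  have hvj : 0 < ‖v j‖ := (norm_pos_iff.2 hi0).trans_le (hj i0)
  have hvj0 : v j ≠ 0 := norm_pos_iff.1 hvj
  refine ⟨fun i => ⟨(v j)⁻¹ * v i, ?_⟩, j, hvj0, ?_, hj, fun i => rfl⟩
  · rw [norm_mul, norm_inv, inv_mul_le_iff₀ hvj, mul_one]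
    exact hj i
  · exact Subtype.ext (inv_mul_cancel₀ hvj0)

theorem exists_primitive_of_isIsotropic_extend {f : QuadraticForm ℤ_[p] (Fin n → ℤ_[p])}
    (h : IsIsotropic (extend ℚ_[p] f)) : ∃ (w : Fin n → ℤ_[p]) (j : Fin n), w j = 1 ∧ f w = 0 := by
  obtain ⟨v, hv, h0⟩ := h
  obtain ⟨w, j, -, hwj, -, hw⟩ := exists_primitive hv
  refine ⟨w, j, hwj, ?_⟩
  have h1 := extend_algebraMap ℚ_[p] f w
  have h2 : (fun i => algebraMap ℤ_[p] ℚ_[p] (w i)) = (v j)⁻¹ • v := by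
    ext i
    exact hw i
  rw [h2, QuadraticMap.map_smul, h0, smul_zero] at h1
  exact IsFractionRing.injective ℤ_[p] ℚ_[p] (by rw [← h1, map_zero])

theorem IsIsotropic.extend {R A : Type*} [CommRing R] [CommRing A] [IsDomain A] [CharZero A]
    [Algebra R A] [FaithfulSMul R A] {f : QuadraticForm R (Fin n → R)} (h : IsIsotropic f) :
    IsIsotropic (extend A f) := by
  obtain ⟨v, hv, h0⟩ := h
  refine ⟨fun i => algebraMap R A (v i), fun hv' => hv ?_, by rw [extend_algebraMap, h0, map_zero]⟩
  ext i
  exact FaithfulSMul.algebraMap_injective R A (by simpa using congrFun hv' i)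

theorem isIsotropic_extend_padic_iff (f : QuadraticForm ℤ_[p] (Fin n → ℤ_[p])) :
    IsIsotropic (IntegralForms.extend ℚ_[p] f) ↔ IsIsotropic f := by
  refine ⟨fun h => ?_, fun h => h.extend⟩
  obtain ⟨w, j, hwj, h0⟩ := exists_primitive_of_isIsotropic_extend h
  refine ⟨w, fun hw => ?_, h0⟩
  rw [hw] at hwj
  exact zero_ne_one hwj

/-- Take a primitive zero `w`. If it paired with every basis vector to a nonunit, `p²` would divide
the determinant. So some `e_i` pairs with `w` to a unit `u`, and `f(e_i + t w) = f(e_i) + t u` takes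
every value. -/
theorem isUniversal_of_isIsotropic {f : QuadraticForm ℤ_[p] (Fin n → ℤ_[p])}
    (hdet : ¬ (p : ℤ_[p]) ^ 2 ∣ (gram f).det) (hf : IsIsotropic f) : IsUniversal f := by
  obtain ⟨w, j, hwj, h0⟩ := exists_primitive_of_isIsotropic_extend
    ((isIsotropic_extend_padic_iff f).2 hf)
  have : ∃ i, IsUnit ((gram f *ᵥ w) i) := by
    by_contra! hu
    refine hdet (sq_dvd_det_of_primitive (gram_symm f) (w := w) (j := j) (by simp [hwj]) ?_ ?_)
    · intro i
      rw [← Ideal.mem_span_singleton, ← PadicInt.maximalIdeal_eq_span_p]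
      exact (IsLocalRing.mem_maximalIdeal _).2 (hu i)
    · rw [← two_mul_apply, h0, mul_zero]
      exact dvd_zero _
  obtain ⟨i, u, hu⟩ := this
  intro a _
  refine ⟨Pi.single i 1 + ((a - f (Pi.single i 1)) * (u⁻¹ : ℤ_[p]ˣ)) • w, ?_⟩
  rw [QuadraticMap.map_add f, QuadraticMap.map_smul, h0, QuadraticMap.polar_smul_right,
    polar_eq_dotProduct, single_one_dotProduct, ← hu]
  simp [mul_assoc]

/-- Let `x` be a nonintegral vector of a larger lattice and `w = x / x_j` its primitive multiple,
with `p ∣ x_j⁻¹`. Since `f(x)` and the pairings of `x` with `ℤ_pⁿ` are integral, scaling gives `p ∣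
A w` and `p² ∣ f(w)`, which forces `p²` to divide the determinant. -/
theorem isMaximal_of_not_sq_dvd_det {f : QuadraticForm ℤ_[p] (Fin n → ℤ_[p])}
    (hdet : ¬ (p : ℤ_[p]) ^ 2 ∣ (gram f).det) : IsMaximal ℚ_[p] f := by
  rintro ⟨M, -, hlt, hM⟩
  obtain ⟨hle, x, hxM, hx⟩ := SetLike.lt_iff_le_and_exists.1 hlt
  have hstd : ∀ v : Fin n → ℤ_[p], (fun i => algebraMap ℤ_[p] ℚ_[p] (v i)) ∈ M :=
    fun v => hle ⟨v, rfl⟩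
  have hx0 : x ≠ 0 := fun h => hx (h ▸ zero_mem _)
  obtain ⟨w, j, hxj, hwj, hmax, hw⟩ := exists_primitive hx0
  have hnorm : 1 < ‖x j‖ := by
    by_contra! h
    exact hx ⟨fun i => ⟨x i, (hmax i).trans h⟩, rfl⟩
  have hc1 : ‖(x j)⁻¹‖ < 1 := by
    rw [norm_inv]; exact inv_lt_one_of_one_lt₀ hnorm
  obtain ⟨y, hy⟩ : ∃ y : ℤ_[p], (y : ℚ_[p]) = (x j)⁻¹ := ⟨⟨(x j)⁻¹, hc1.le⟩, rfl⟩
  obtain ⟨d, hd⟩ : (p : ℤ_[p]) ∣ y := by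
    rw [← PadicInt.norm_lt_one_iff_dvd, PadicInt.norm_def, hy]; exact hc1
  have hd' : (x j)⁻¹ = algebraMap ℤ_[p] ℚ_[p] (p * d) := by rw [← hd, ← hy]; rfl
  have hwx : (fun i => algebraMap ℤ_[p] ℚ_[p] (w i)) = (x j)⁻¹ • x := by
    ext i; exact hw i
  have hinj := IsFractionRing.injective ℤ_[p] ℚ_[p]
  have hpol : ∀ v : Fin n → ℤ_[p], ∃ b : ℤ_[p], QuadraticMap.polar (extend ℚ_[p] f)
      (fun i => algebraMap ℤ_[p] ℚ_[p] (v i)) x = algebraMap ℤ_[p] ℚ_[p] b := by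
    intro v
    obtain ⟨a, ha⟩ := hM _ (M.add_mem (hstd v) hxM)
    obtain ⟨b, hb⟩ := hM _ hxM
    refine ⟨a - f v - b, ?_⟩
    rw [QuadraticMap.polar, extend_algebraMap, ← ha, ← hb, map_sub, map_sub]
  refine hdet (sq_dvd_det_of_primitive (gram_symm f) (w := w) (j := j) (by simp [hwj]) ?_ ?_)
  · intro i
    obtain ⟨b, hb⟩ := hpol (Pi.single i 1)
    have : (gram f *ᵥ w) i = (p * d) * b := by
      apply hinj
      rw [← single_one_dotProduct i (gram f *ᵥ w), ← polar_eq_dotProduct, map_mul, ← hb, ← hd', ← smul_eq_mul,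
        ← QuadraticMap.polar_smul_right, ← hwx, QuadraticMap.polar, QuadraticMap.polar, map_sub,
        map_sub, ← extend_algebraMap ℚ_[p], ← extend_algebraMap ℚ_[p], ← extend_algebraMap ℚ_[p]]
      simp only [Pi.add_apply, map_add]
      rfl
    rw [this, mul_assoc]
    exact dvd_mul_right _ _
  · obtain ⟨b, hb⟩ := hM x hxM
    have : f w = (p * d) ^ 2 * b := by
      apply hinj
      rw [← extend_algebraMap ℚ_[p] f w, hwx, QuadraticMap.map_smul, hd', ← hb]
      simp [pow_two]
    rw [← two_mul_apply, this, mul_pow]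
    exact ⟨2 * (d ^ 2 * b), by ring⟩

end Maximal

end IntegralForms

namespace IntegralForms

open Matrix

/-! ### Isotropy over `ℤ_p` by zeros modulo `p` and Hensel's lemma -/

section Isotropy

/-- The matrix has corank at most one modulo `π`. Otherwise `adj A = π B` and `det A = π δ`, so `A B
= δ` and `det A * det B = δ ^ n`; then `π ∣ δ` and `π² ∣ det A`. -/
theorem exists_not_dvd_adjugate {R : Type*} [CommRing R] [IsDomain R] {n : ℕ} (hn : n ≠ 0)
    {A : Matrix (Fin n) (Fin n) R} {π : R} (hπ : Prime π) (h : ¬ π ^ 2 ∣ A.det) :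
    ∃ i j, ¬ π ∣ A.adjugate i j := by
  by_contra! hB
  choose B hB using hB
  have hadj : A.adjugate = π • (Matrix.of B) := by
    ext i j; simp [hB]
  have h1 := Matrix.mul_adjugate A
  rw [hadj, Matrix.mul_smul] at h1
  let i0 : Fin n := ⟨0, Nat.pos_of_ne_zero hn⟩
  have hd : π ∣ A.det := by
    have := congrFun (congrFun h1 i0) i0
    simp only [Matrix.smul_apply, Matrix.one_apply_eq, smul_eq_mul, mul_one] at this
    exact ⟨_, this.symm⟩
  obtain ⟨δ, hδ⟩ := hd
  have h2 : A * Matrix.of B = δ • (1 : Matrix (Fin n) (Fin n) R) := by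
    rw [hδ, mul_smul] at h1
    exact smul_right_injective _ hπ.ne_zero h1
  have h3 : A.det * (Matrix.of B).det = δ ^ n := by
    rw [← Matrix.det_mul, h2, Matrix.det_smul, Matrix.det_one, Fintype.card_fin, mul_one]
  have h4 : π ∣ δ := hπ.dvd_of_dvd_pow (n := n) (by
    rw [← h3, hδ, mul_assoc]; exact dvd_mul_right _ _)
  apply h
  rw [hδ, pow_two]
  exact mul_dvd_mul_left _ h4

/-- The cofactor is the determinant of `A` with row `j` replaced by `e_i`, and that matrix kills
`x`. -/
theorem exists_eq_zero_of_adjugate_ne_zero {K : Type*} [Field K] {n : ℕ}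
    {A : Matrix (Fin n) (Fin n) K} {i j : Fin n} (h : A.adjugate i j ≠ 0) {x : Fin n → K}
    (hx : A *ᵥ x = 0) (hxi : x i = 0) : x = 0 := by
  rw [Matrix.adjugate_apply] at h
  refine Matrix.eq_zero_of_mulVec_eq_zero h ?_
  ext k
  rcases eq_or_ne k j with rfl | hk
  · simp [Matrix.mulVec, hxi]
  · simpa [Matrix.mulVec, Matrix.updateRow_ne hk] using congrFun hx k

/-- By Chevalley–Warning the number of zeros is divisible by `p`, so the origin is not the only one.
-/
theorem exists_ne_zero_dotProduct_mulVec_eq_zero {p : ℕ} [Fact p.Prime] {m : ℕ} (hm : 3 ≤ m)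
    (A : Matrix (Fin m) (Fin m) (ZMod p)) : ∃ x : Fin m → ZMod p, x ≠ 0 ∧ x ⬝ᵥ A *ᵥ x = 0 := by
  classical
  let F : MvPolynomial (Fin m) (ZMod p) :=
    ∑ i, ∑ j, MvPolynomial.C (A i j) * (MvPolynomial.X i * MvPolynomial.X j)
  have heval : ∀ x, MvPolynomial.eval x F = x ⬝ᵥ A *ᵥ x := by
    intro x
    simp only [F, map_sum, map_mul, MvPolynomial.eval_C, MvPolynomial.eval_X, dotProduct,
      Matrix.mulVec, Finset.mul_sum]
    exact Finset.sum_congr rfl fun i _ => Finset.sum_congr rfl fun j _ => by ring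
  have hdeg : F.totalDegree ≤ 2 := by
    refine MvPolynomial.totalDegree_finsetSum_le fun i _ =>
      MvPolynomial.totalDegree_finsetSum_le fun j _ => ?_
    refine (MvPolynomial.totalDegree_mul _ _).trans ?_
    rw [MvPolynomial.totalDegree_C, zero_add]
    refine (MvPolynomial.totalDegree_mul _ _).trans ?_
    rw [MvPolynomial.totalDegree_X, MvPolynomial.totalDegree_X]
  have hdvd := char_dvd_card_solutions p (f := F) (by rw [Fintype.card_fin]; omega)
  by_contra! h
  have : Fintype.card {x // MvPolynomial.eval x F = 0} = 1 := by
    rw [Fintype.card_eq_one_iff]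
    refine ⟨⟨0, by rw [heval]; simp⟩, fun y => Subtype.ext ?_⟩
    by_contra hy
    exact h _ hy (by rw [← heval]; exact y.2)
  rw [this, Nat.dvd_one] at hdvd
  exact (Fact.out : p.Prime).one_lt.ne' hdvd

/-- The hyperplane `x_i = 0` has dimension at least 3, hence contains a nontrivial zero, and it
meets the kernel of `A` only in 0. -/
theorem exists_dotProduct_eq_zero_mulVec_ne_zero {p : ℕ} [Fact p.Prime] {n : ℕ} (hn : 4 ≤ n)
    {A : Matrix (Fin n) (Fin n) (ZMod p)} {i j : Fin n} (h : A.adjugate i j ≠ 0) :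
    ∃ x : Fin n → ZMod p, x ⬝ᵥ A *ᵥ x = 0 ∧ A *ᵥ x ≠ 0 := by
  obtain ⟨m, rfl⟩ : ∃ m, n = m + 1 := ⟨n - 1, by omega⟩
  obtain ⟨y, hy, hy0⟩ := exists_ne_zero_dotProduct_mulVec_eq_zero (m := m) (by omega)
    (A.submatrix i.succAbove i.succAbove)
  have hxi : (i.insertNth 0 y : Fin (m + 1) → ZMod p) i = 0 := by simp
  refine ⟨i.insertNth 0 y, ?_, fun hA => hy ?_⟩
  · refine Eq.trans ?_ hy0
    simp [dotProduct, Matrix.mulVec, Fin.sum_univ_succAbove _ i]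
  · have := exists_eq_zero_of_adjugate_ne_zero h hA hxi
    ext k
    simpa using congrFun this (i.succAbove k)

variable {p : ℕ} [Fact p.Prime] {n : ℕ}

theorem toZMod_eq_zero_iff (a : ℤ_[p]) : PadicInt.toZMod a = 0 ↔ (p : ℤ_[p]) ∣ a := by
  rw [← RingHom.mem_ker, PadicInt.ker_toZMod, PadicInt.maximalIdeal_eq_span_p,
    Ideal.mem_span_singleton]

/-- Hensel's lemma applies at `z = 0` to the polynomial `f(z e_i + w)`, whose derivative there is
the unit `b`. -/
theorem isIsotropic_of_dvd {f : QuadraticForm ℤ_[p] (Fin n → ℤ_[p])} {w : Fin n → ℤ_[p]}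
    (h0 : (p : ℤ_[p]) ∣ f w) {i : Fin n} (hi : ¬ (p : ℤ_[p]) ∣ (gram f *ᵥ w) i) :
    IsIsotropic f := by
  set b := (gram f *ᵥ w) i with hb
  have hpol : QuadraticMap.polar f (Pi.single i 1) w = b := by
    rw [polar_eq_dotProduct, single_one_dotProduct]
  have hb1 : ‖b‖ = 1 := by
    rw [← PadicInt.norm_lt_one_iff_dvd] at hi
    exact le_antisymm (PadicInt.norm_le_one _) (not_lt.1 hi)
  let F : Polynomial ℤ_[p] := Polynomial.C (f w) + Polynomial.C b * Polynomial.X +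
    Polynomial.C (f (Pi.single i 1)) * Polynomial.X ^ 2
  have hF : ∀ z, Polynomial.aeval z F = f w + b * z + f (Pi.single i 1) * z ^ 2 := by
    intro z; simp [F]
  have hF' : Polynomial.aeval (0 : ℤ_[p]) (Polynomial.derivative F) = b := by
    simp [F]
  obtain ⟨z, hz, hz1, -⟩ := hensels_lemma (p := p) (F := F) (a := (0 : ℤ_[p])) (by
    rw [hF, hF', hb1]
    simpa using (PadicInt.norm_lt_one_iff_dvd _).2 h0)
  rw [hF', hb1, sub_zero, PadicInt.norm_lt_one_iff_dvd] at hz1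
  -- The root `z` is divisible by `p`; were the vector zero, `w` and hence `b` would be divisible by
  -- `p`.
  refine ⟨z • Pi.single i 1 + w, fun h => hi ?_, ?_⟩
  · have hw : w = -(z • Pi.single i 1) := by
      rw [eq_neg_iff_add_eq_zero, add_comm]; exact h
    rw [hb, hw, Matrix.mulVec_neg, Matrix.mulVec_smul]
    simpa using hz1.mul_right _
  · rw [QuadraticMap.map_add f, QuadraticMap.map_smul, QuadraticMap.polar_smul_left, hpol, ← hz, hF]
    simp only [smul_eq_mul]
    ring

theorem isIsotropic_of_zmod (hp2 : p ≠ 2) {f : QuadraticForm ℤ_[p] (Fin n → ℤ_[p])}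
    {x : Fin n → ZMod p} (h0 : x ⬝ᵥ (gram f).map PadicInt.toZMod *ᵥ x = 0)
    (h1 : (gram f).map PadicInt.toZMod *ᵥ x ≠ 0) : IsIsotropic f := by
  have hs : Function.Surjective (PadicInt.toZMod (p := p)) := ZMod.ringHom_surjective _
  choose w hw using fun i => hs (x i)
  have hxw : x = fun i => PadicInt.toZMod (w i) := funext fun i => (hw i).symm
  have hmul : ∀ i, PadicInt.toZMod ((gram f *ᵥ w) i) =
      ((gram f).map PadicInt.toZMod *ᵥ x) i := by
    intro i
    rw [hxw]
    simp [Matrix.mulVec, dotProduct]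
  obtain ⟨i, hi⟩ := Function.ne_iff.1 h1
  refine isIsotropic_of_dvd (w := w) (i := i) ?_ ?_
  · have h2 : PadicInt.toZMod (2 * f w) = 0 := by
      rw [two_mul_apply, dotProduct, map_sum, ← h0, dotProduct]
      exact Finset.sum_congr rfl fun i _ => by rw [map_mul, hmul, hw]
    rw [map_mul, map_ofNat, mul_eq_zero] at h2
    rcases h2 with h2 | h2
    · exfalso
      have : ((2 : ℕ) : ZMod p) = 0 := by exact_mod_cast h2
      rw [ZMod.natCast_eq_zero_iff] at this
      exact hp2 ((Nat.prime_dvd_prime_iff_eq Fact.out Nat.prime_two).1 this)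
    · exact (toZMod_eq_zero_iff _).1 h2
  · rw [← toZMod_eq_zero_iff, hmul]
    exact hi

theorem isIsotropic_of_not_dvd_det (hp2 : p ≠ 2) (hn : 3 ≤ n)
    {f : QuadraticForm ℤ_[p] (Fin n → ℤ_[p])} (hdet : ¬ (p : ℤ_[p]) ∣ (gram f).det) :
    IsIsotropic f := by
  obtain ⟨x, hx, h0⟩ := exists_ne_zero_dotProduct_mulVec_eq_zero hn
    ((gram f).map (PadicInt.toZMod (p := p)))
  refine isIsotropic_of_zmod hp2 h0 fun h => hx (Matrix.eq_zero_of_mulVec_eq_zero ?_ h)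
  rw [← toZMod_eq_zero_iff, RingHom.map_det] at hdet
  exact hdet

theorem isIsotropic_of_not_sq_dvd_det (hp2 : p ≠ 2) (hn : 4 ≤ n)
    {f : QuadraticForm ℤ_[p] (Fin n → ℤ_[p])} (hdet : ¬ (p : ℤ_[p]) ^ 2 ∣ (gram f).det) :
    IsIsotropic f := by
  obtain ⟨i, j, hij⟩ := exists_not_dvd_adjugate (by omega) PadicInt.prime_p hdet
  have : ((gram f).map (PadicInt.toZMod (p := p))).adjugate i j ≠ 0 := by
    rw [← toZMod_eq_zero_iff] at hij
    have h := RingHom.map_adjugate (PadicInt.toZMod (p := p)) (gram f)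
    rw [RingHom.mapMatrix_apply, RingHom.mapMatrix_apply] at h
    rw [← h]
    exact hij
  obtain ⟨x, h0, h1⟩ := exists_dotProduct_eq_zero_mulVec_ne_zero hn this
  exact isIsotropic_of_zmod hp2 h0 h1

end Isotropy

end IntegralForms

namespace IntegralForms

open Matrix

/-! ### Bordered matrices and their determinants -/

section Border

variable {R : Type*} {n : ℕ}

/-- The symmetric matrix `A` enlarged by a last row and column `v` and a corner entry `d`. -/
def border (A : Matrix (Fin n) (Fin n) R) (v : Fin n → R) (d : R) :
    Matrix (Fin (n + 1)) (Fin (n + 1)) R :=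
  Matrix.reindex finSumFinEquiv finSumFinEquiv
    (Matrix.fromBlocks A (Matrix.replicateCol (Fin 1) v) (Matrix.replicateRow (Fin 1) v)
      (Matrix.of fun _ _ => d))

variable (A : Matrix (Fin n) (Fin n) R) (v : Fin n → R) (d : R)

@[simp] theorem finSumFinEquiv_symm_castSucc (i : Fin n) :
    (finSumFinEquiv (m := n) (n := 1)).symm i.castSucc = Sum.inl i :=
  finSumFinEquiv_symm_apply_castAdd i

@[simp] theorem finSumFinEquiv_symm_last_one :
    (finSumFinEquiv (m := n) (n := 1)).symm (Fin.last n) = Sum.inr 0 :=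
  finSumFinEquiv_symm_apply_natAdd 0

@[simp] theorem border_castSucc_castSucc (i j : Fin n) :
    border A v d i.castSucc j.castSucc = A i j := by
  simp [border]

@[simp] theorem border_castSucc_last (i : Fin n) : border A v d i.castSucc (Fin.last n) = v i := by
  simp [border]

@[simp] theorem border_last_castSucc (i : Fin n) : border A v d (Fin.last n) i.castSucc = v i := by
  simp [border]

@[simp] theorem border_last_last : border A v d (Fin.last n) (Fin.last n) = d := by
  simp [border]

theorem border_transpose (hA : Aᵀ = A) : (border A v d)ᵀ = border A v d := by
  ext i j
  rw [Matrix.transpose_apply]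
  have hs : ∀ i j, A j i = A i j := fun i j => by
    conv_rhs => rw [← hA, Matrix.transpose_apply]
  refine Fin.lastCases ?_ (fun i => ?_) i <;> refine Fin.lastCases ?_ (fun j => ?_) j <;> simp [hs]

theorem det_border {R : Type*} [CommRing R] [IsDomain R] (A : Matrix (Fin n) (Fin n) R)
    (v : Fin n → R) (d : R) (hA : A.det ≠ 0) :
    (border A v d).det = d * A.det - v ⬝ᵥ A.adjugate *ᵥ v := by
  rw [border, Matrix.det_reindex_self]
  set B := Matrix.replicateCol (Fin 1) v
  set C := Matrix.replicateRow (Fin 1) v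
  set D : Matrix (Fin 1) (Fin 1) R := Matrix.of fun _ _ => d
  -- The Schur complement with denominators cleared by the adjugate; taking determinants, a power of
  -- `det A` cancels at the end.
  have key : fromBlocks A B C D * fromBlocks A.adjugate (-(A.adjugate * B)) 0 (A.det • 1) =
      fromBlocks (A.det • 1) 0 (C * A.adjugate) (A.det • D - C * A.adjugate * B) := by
    rw [Matrix.fromBlocks_multiply]
    congr 1
    · simp [Matrix.mul_adjugate]
    · rw [Matrix.mul_neg, ← Matrix.mul_assoc, Matrix.mul_adjugate]; simp
    · simp
    · simp [Matrix.mul_assoc, sub_eq_add_neg, add_comm]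
  have h1 := congrArg Matrix.det key
  rw [Matrix.det_mul, Matrix.det_fromBlocks_zero₂₁, Matrix.det_fromBlocks_zero₁₂,
    Matrix.det_fin_one (_ - _), Matrix.det_smul, Matrix.det_smul] at h1
  have h2 : A.det * A.adjugate.det = A.det ^ n := by
    rw [← Matrix.det_mul, Matrix.mul_adjugate, Matrix.det_smul]; simp
  have h3 : (A.det • D - C * A.adjugate * B) 0 0 = d * A.det - v ⬝ᵥ A.adjugate *ᵥ v := by
    rw [Matrix.mul_assoc]
    simp [D, B, C, mul_comm, Matrix.mul_apply, dotProduct, Matrix.mulVec]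
  rw [h3] at h1
  simp only [Fintype.card_fin, pow_one, Matrix.det_one, mul_one] at h1
  apply mul_right_cancel₀ (pow_ne_zero n hA)
  rw [← h2]
  calc _ = (fromBlocks A B C D).det * (A.adjugate.det * A.det) := by ring
    _ = _ := by rw [h1, h2]; ring

end Border

/-! ### Effect of bordering on the real signature -/

section Signature

variable {n : ℕ}

/-- Completing the square leaves the new diagonal entry `δ`, the Schur complement, equal to the
ratio of the two determinants. If `ε` has the sign of `δ`, rescaling by `√(δ / ε)` turns it into
`ε`. -/
theorem border_eq_congruent {A Q : Matrix (Fin n) (Fin n) ℝ} {w : Fin n → ℝ}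
    (hQ : IsUnit Q.det) (hA : A = Qᵀ * diagonal w * Q) (hdet : A.det ≠ 0) (v : Fin n → ℝ) (d : ℝ)
    {ε : ℝ} (hε : 0 < ε * ((border A v d).det / A.det)) :
    ∃ Q' : Matrix (Fin (n + 1)) (Fin (n + 1)) ℝ, IsUnit Q'.det ∧
      border A v d = Q'ᵀ * diagonal (Fin.snoc (α := fun _ => ℝ) w ε) * Q' := by
  have hdw : IsUnit (diagonal w).det := by
    rw [hA, Matrix.det_mul] at hdet
    rw [Matrix.det_mul] at hdet
    exact isUnit_iff_ne_zero.2 (right_ne_zero_of_mul (left_ne_zero_of_mul hdet))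
  have hQt : IsUnit Qᵀ.det := by rwa [Matrix.det_transpose]
  obtain ⟨y, hy⟩ : ∃ y : Matrix (Fin n) (Fin 1) ℝ,
      Qᵀ * diagonal w * y = Matrix.replicateCol (Fin 1) v := by
    refine ⟨(diagonal w)⁻¹ * Qᵀ⁻¹ * Matrix.replicateCol (Fin 1) v, ?_⟩
    rw [Matrix.mul_assoc, ← Matrix.mul_assoc (diagonal w), ← Matrix.mul_assoc (diagonal w),
      Matrix.mul_nonsing_inv _ hdw, Matrix.one_mul, ← Matrix.mul_assoc,
      Matrix.mul_nonsing_inv _ hQt, Matrix.one_mul]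
  have hy' : yᵀ * diagonal w * Q = Matrix.replicateRow (Fin 1) v := by
    have := congrArg Matrix.transpose hy
    rw [Matrix.transpose_mul _ y, Matrix.transpose_mul, Matrix.transpose_transpose,
      Matrix.diagonal_transpose, ← Matrix.mul_assoc, Matrix.transpose_replicateCol] at this
    exact this
  set δ : ℝ := d - (yᵀ * diagonal w * y) 0 0 with hδ
  have main : ∀ t : ℝ, ε * t ^ 2 = δ → border A v d =
      (Matrix.reindex finSumFinEquiv finSumFinEquiv (fromBlocks Q y 0 (t • 1)))ᵀ *
        diagonal (Fin.snoc (α := fun _ => ℝ) w ε) *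
        (Matrix.reindex finSumFinEquiv finSumFinEquiv (fromBlocks Q y 0 (t • 1))) := by
    intro t ht
    have hdiag : diagonal (Fin.snoc (α := fun _ => ℝ) w ε) =
        Matrix.reindex (finSumFinEquiv (m := n) (n := 1)) finSumFinEquiv
          (fromBlocks (diagonal w) 0 0 (ε • 1)) := by
      ext i j
      refine Fin.lastCases ?_ (fun i => ?_) i <;> refine Fin.lastCases ?_ (fun j => ?_) j <;>
        simp [Matrix.diagonal_apply, Fin.castSucc_ne_last, (Fin.castSucc_ne_last _).symm]
    rw [hdiag]
    simp only [Matrix.reindex_apply, Matrix.transpose_submatrix, Matrix.submatrix_mul_equiv, border]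
    congr 1
    rw [Matrix.fromBlocks_transpose, Matrix.fromBlocks_multiply, Matrix.fromBlocks_multiply]
    simp only [Matrix.transpose_zero, Matrix.zero_mul, Matrix.mul_zero, add_zero, zero_add,
      hy, hy', ← hA]
    congr 1
    ext i j
    fin_cases i; fin_cases j
    simp
    linarith
  have hδdet : (border A v d).det = A.det * δ := by
    rw [border, Matrix.det_reindex_self]
    have e1 : fromBlocks A (replicateCol (Fin 1) v) (replicateRow (Fin 1) v)
        (Matrix.of fun _ _ => d) = (fromBlocks Q y 0 1)ᵀ *
          fromBlocks (diagonal w) 0 0 (δ • 1) * fromBlocks Q y 0 1 := by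
      rw [Matrix.fromBlocks_transpose, Matrix.fromBlocks_multiply, Matrix.fromBlocks_multiply]
      simp only [Matrix.transpose_zero, Matrix.zero_mul, Matrix.mul_zero, add_zero, zero_add,
        hy, hy', ← hA]
      congr 1
      ext i j
      fin_cases i; fin_cases j
      simp [hδ]
    rw [e1, hA]
    simp [Matrix.det_mul, Matrix.det_transpose, Matrix.det_fromBlocks_zero₂₁]
    ring
  rw [hδdet, mul_div_cancel_left₀ _ hdet] at hε
  have hε0 : ε ≠ 0 := fun h => by simp [h] at hε
  have hpos : 0 < δ / ε := by
    rw [div_eq_mul_inv]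
    have : δ * ε⁻¹ = (ε * δ) * (ε⁻¹) ^ 2 := by field_simp
    rw [this]
    positivity
  refine ⟨_, ?_, main (Real.sqrt (δ / ε)) ?_⟩
  · rw [Matrix.det_reindex_self, Matrix.det_fromBlocks_zero₂₁]
    refine hQ.mul (isUnit_iff_ne_zero.2 ?_)
    simp [(Real.sqrt_pos.2 hpos).ne']
  · rw [Real.sq_sqrt hpos.le]
    field_simp

end Signature

/-! ### Dirichlet's theorem and the inductive construction of the global matrix -/

section Dirichlet

/-- After division by the gcd, `ε a'` is prime to `b'`; Dirichlet's theorem gives a large prime `q`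
in its class modulo `b'`. -/
theorem exists_add_mul_eq_gcd_mul_prime (a : ℤ) {b : ℤ} (hb : b ≠ 0) {ε : ℤ} (hε : ε * ε = 1)
    (B : ℕ) : ∃ (k : ℤ) (q : ℕ), q.Prime ∧ B < q ∧ a + b * k = ε * (Int.gcd a b * q) := by
  have hg : 0 < Int.gcd a b := Int.gcd_pos_of_ne_zero_right _ hb
  obtain ⟨a', b', hcop, ha', hb'⟩ := Int.exists_gcd_one hg
  set g := Int.gcd a b
  have hb'0 : b' ≠ 0 := by rintro rfl; simp [hb] at hb'
  have : NeZero b'.natAbs := ⟨Int.natAbs_ne_zero.2 hb'0⟩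
  have hunit : IsUnit ((ε * a' : ℤ) : ZMod b'.natAbs) := by
    have h1 : IsCoprime (ε * a') b' := by
      refine IsCoprime.mul_left ?_ (Int.isCoprime_iff_gcd_eq_one.2 hcop)
      exact ⟨ε, 0, by rw [hε]; ring⟩
    obtain ⟨x, y, hxy⟩ := h1
    have h2 := congrArg (Int.cast : ℤ → ZMod b'.natAbs) hxy
    have h3 : ((b' : ℤ) : ZMod b'.natAbs) = 0 := by
      rw [ZMod.intCast_zmod_eq_zero_iff_dvd]; exact Int.natAbs_dvd.2 dvd_rfl
    rw [Int.cast_add, Int.cast_mul, Int.cast_mul y, h3, mul_zero, add_zero, Int.cast_one] at h2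
    exact IsUnit.of_mul_eq_one _ (by rw [mul_comm]; exact h2)
  obtain ⟨q, hqB, hq, hqa⟩ := Nat.forall_exists_prime_gt_and_eq_mod hunit B
  have : b' ∣ q - ε * a' := by
    rw [← Int.natAbs_dvd, ← ZMod.intCast_zmod_eq_zero_iff_dvd]
    push_cast
    rw [hqa]; push_cast; ring
  obtain ⟨k, hk⟩ := this
  refine ⟨ε * k, q, hq, hqB, ?_⟩
  have hq' : (q : ℤ) = ε * a' + b' * k := by linarith
  rw [hq', ha', hb']
  linear_combination (-a' * g) * hε

theorem dotProduct_mulVec_add_smul {R : Type*} [CommRing R] {n : ℕ} (A : Matrix (Fin n) (Fin n) R)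
    (x y : Fin n → R) (c : R) : ∃ e, (x + c • y) ⬝ᵥ A *ᵥ (x + c • y) = x ⬝ᵥ A *ᵥ x + c * e :=
  ⟨x ⬝ᵥ A *ᵥ y + y ⬝ᵥ A *ᵥ x + c * (y ⬝ᵥ A *ᵥ y), by
    simp only [Matrix.mulVec_add, Matrix.mulVec_smul, dotProduct_add, add_dotProduct,
      dotProduct_smul, smul_dotProduct, smul_eq_mul]
    ring⟩

/-- By polarization, a quadratic form vanishing identically modulo `π` has `2 A i j` divisible by
`π`. -/
theorem exists_not_dvd_dotProduct_mulVec {R : Type*} [CommRing R] {n : ℕ}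
    {A : Matrix (Fin n) (Fin n) R} (hA : Aᵀ = A) {π : R} (hπ : Prime π) (h2 : ¬ π ∣ 2)
    {i j : Fin n} (hij : ¬ π ∣ A i j) : ∃ x : Fin n → R, ¬ π ∣ x ⬝ᵥ A *ᵥ x := by
  by_contra! h
  have hii : ∀ i, π ∣ A i i := fun i => by simpa using h (Pi.single i 1)
  have hs : A j i = A i j := by conv_rhs => rw [← hA, Matrix.transpose_apply]
  have := h (Pi.single i 1 + Pi.single j 1)
  simp only [Matrix.mulVec_add, dotProduct_add, add_dotProduct] at this
  simp only [mulVec_single_one, single_one_dotProduct, Matrix.col_apply, hs] at this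
  have h3 : π ∣ 2 * A i j := by
    have := this.sub ((hii i).add (hii j))
    ring_nf at this ⊢
    exact this
  exact (hπ.dvd_or_dvd h3).elim h2 hij

theorem sign_div_self_pos {D : ℤ} (hD : D ≠ 0) : (0 : ℝ) < D.sign / (D : ℝ) := by
  rcases lt_or_gt_of_ne hD with h | h
  · rw [Int.sign_eq_neg_one_of_neg h]
    have : (D : ℝ) < 0 := by exact_mod_cast h
    exact div_pos_of_neg_of_neg (by norm_num) this
  · rw [Int.sign_eq_one_of_pos h]
    have : (0 : ℝ) < D := by exact_mod_cast h
    exact div_pos (by norm_num) this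

/-- Approximation of a symmetric integral matrix with even diagonal by one with prescribed real
signature, whose determinant is squarefree away from `S` with at most one prime factor there. -/
theorem exists_approximation {S : Finset ℕ} (h2S : 2 ∈ S) {M : ℕ} (hM0 : M ≠ 0)
    (hM : ∀ p, p.Prime → p ∣ M → p ∈ S) : ∀ {n : ℕ} (A₀ : Matrix (Fin n) (Fin n) ℤ),
    A₀ᵀ = A₀ → (∀ i, 2 ∣ A₀ i i) → ∀ r s : ℕ, r + s = n →
    ∃ A : Matrix (Fin n) (Fin n) ℤ, Aᵀ = A ∧ (∀ i, 2 ∣ A i i) ∧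
      (∀ i j, (M : ℤ) ∣ A i j - A₀ i j) ∧ A.det ≠ 0 ∧
      (∃ l : ℕ, l.Prime ∧ l ∉ S ∧ (∀ p : ℕ, p.Prime → p ∉ S → (p : ℤ) ∣ A.det → p = l) ∧
        ¬ (l : ℤ) ^ 2 ∣ A.det) ∧
      ∃ Q : Matrix (Fin n) (Fin n) ℝ, IsUnit Q.det ∧ A.map (Int.castRingHom ℝ) =
        Qᵀ * diagonal (fun i : Fin n => if (i : ℕ) < r then (2 : ℝ) else -2) * Q := by
  intro n
  induction n with
  | zero =>
    intro A₀ hA₀ _ r s _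
    -- The empty determinant is 1, so any prime outside `S` serves as `l`.
    obtain ⟨l, hl, hlp⟩ := Nat.exists_infinite_primes (S.sup id + 1)
    refine ⟨A₀, hA₀, fun i => i.elim0, fun i => i.elim0, by simp, ⟨l, hlp, fun h => ?_, ?_, ?_⟩,
      1, by simp, by ext i; exact i.elim0⟩
    · have : l ≤ S.sup id := Finset.le_sup (f := id) h
      omega
    · intro p hp _ hd
      rw [Matrix.det_isEmpty] at hd
      exact absurd (Int.natCast_dvd_natCast.1 (by exact_mod_cast hd)) (by simpa using hp.one_lt.ne')
    · intro hd
      rw [Matrix.det_isEmpty] at hd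
      have h1 : (l : ℤ) ∣ 1 := (dvd_pow_self _ two_ne_zero).trans hd
      exact absurd (Int.natCast_dvd_natCast.1 (by exact_mod_cast h1)) (by simpa using hlp.one_lt.ne')
  | succ n ih =>
    intro A₀ hA₀ hev r s hrs
    -- The last sign is negative whenever `s > 0`, so dropping it leaves the positive entries as an
    -- initial segment.
    obtain ⟨r', s', ε, hε, hrs', hw⟩ : ∃ (r' s' : ℕ) (ε : ℤ), ε * ε = 1 ∧ r' + s' = n ∧
        (fun i : Fin (n + 1) => if (i : ℕ) < r then (2 : ℝ) else -2) =
          Fin.snoc (α := fun _ => ℝ) (fun i : Fin n => if (i : ℕ) < r' then (2 : ℝ) else -2)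
            (2 * ε) := by
      rcases Nat.eq_zero_or_pos s with hs | hs
      · refine ⟨n, 0, 1, by norm_num, by omega, ?_⟩
        ext i
        refine Fin.lastCases ?_ (fun i => ?_) i
        · simp; omega
        · simp; omega
      · refine ⟨r, s - 1, -1, by norm_num, by omega, ?_⟩
        ext i
        refine Fin.lastCases ?_ (fun i => ?_) i
        · simp; omega
        · simp
    obtain ⟨A, hA, hAev, hAM, hAdet, ⟨l, hl, hlS, hlA, hl2⟩, Q, hQ, hAQ⟩ := ih
      (A₀.submatrix Fin.castSucc Fin.castSucc)
      (by rw [Matrix.transpose_submatrix, hA₀]) (fun i => hev _) r' s' hrs'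
    have hA₀s : ∀ i j, A₀ j i = A₀ i j := fun i j => by
      conv_rhs => rw [← hA₀, Matrix.transpose_apply]
    obtain ⟨c₀, hc₀⟩ := hev (Fin.last n)
    let v₀ : Fin n → ℤ := fun i => A₀ i.castSucc (Fin.last n)
    -- If `l` divides `det A`, the adjugate is nonzero modulo `l`, so its quadratic form is a unit
    -- at some `z`. As `l` is prime to `M`, the border can be congruent to `v₀` modulo `M` and to
    -- `z` modulo `l`.
    obtain ⟨v, hvM, hvl⟩ : ∃ v : Fin n → ℤ, (∀ i, (M : ℤ) ∣ v i - v₀ i) ∧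
        ((l : ℤ) ∣ A.det → ¬ (l : ℤ) ∣ v ⬝ᵥ A.adjugate *ᵥ v) := by
      by_cases hld : (l : ℤ) ∣ A.det
      · have hn0 : n ≠ 0 := by
          rintro rfl
          rw [Matrix.det_isEmpty] at hld
          exact absurd (Int.natCast_dvd_natCast.1 (by exact_mod_cast hld))
            (by simpa using hl.one_lt.ne')
        have hlZ : Prime (l : ℤ) := Nat.prime_iff_prime_int.1 hl
        obtain ⟨i, j, hij⟩ := exists_not_dvd_adjugate hn0 hlZ hl2
        obtain ⟨z, hz⟩ := exists_not_dvd_dotProduct_mulVec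
          (by rw [Matrix.adjugate_transpose, hA]) hlZ (fun h => hlS (by
            have : l ∣ 2 := by exact_mod_cast h
            rwa [(Nat.prime_dvd_prime_iff_eq hl Nat.prime_two).1 this])) hij
        have hcop : IsCoprime (M : ℤ) l := by
          rw [Nat.isCoprime_iff_coprime, Nat.coprime_comm, hl.coprime_iff_not_dvd]
          exact fun h => hlS (hM l hl h)
        obtain ⟨a, b, hab⟩ := hcop
        refine ⟨v₀ + ((M : ℤ) * a) • (z - v₀), fun i => ?_, fun _ => ?_⟩
        · simp [mul_assoc]
        · have : v₀ + ((M : ℤ) * a) • (z - v₀) = z + (l : ℤ) • ((-b) • (z - v₀)) := by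
            have : (M : ℤ) * a = 1 - b * l := by linarith
            rw [this, sub_smul, one_smul, smul_smul]
            ext i
            simp
            ring
          rw [this]
          obtain ⟨e, he⟩ := dotProduct_mulVec_add_smul A.adjugate z ((-b) • (z - v₀)) (l : ℤ)
          rw [he]
          exact fun h => hz ((Int.dvd_add_left (dvd_mul_right _ _)).1 h)
      · exact ⟨v₀, fun i => by simp, fun h => absurd h hld⟩
    have hM0' : (M : ℤ) ≠ 0 := by exact_mod_cast hM0
    -- With corner entry `2 (c₀ + M k)` the bordered determinant is `a + b k`.
    set a : ℤ := 2 * c₀ * A.det - v ⬝ᵥ A.adjugate *ᵥ v with ha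
    set b : ℤ := 2 * M * A.det with hb
    have hb0 : b ≠ 0 := mul_ne_zero (mul_ne_zero two_ne_zero hM0') hAdet
    have hσ : (ε * A.det.sign) * (ε * A.det.sign) = 1 := by
      have : A.det.sign * A.det.sign = 1 := by
        rcases lt_or_gt_of_ne hAdet with h | h
        · rw [Int.sign_eq_neg_one_of_neg h]; norm_num
        · rw [Int.sign_eq_one_of_pos h]; norm_num
      calc _ = (ε * ε) * (A.det.sign * A.det.sign) := by ring
        _ = 1 := by rw [hε, this]; norm_num
    -- The lower bound puts `q` outside `S` and makes it larger than the gcd, so `q²` cannot divide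
    -- the determinant.
    obtain ⟨k, q, hq, hqB, hk⟩ := exists_add_mul_eq_gcd_mul_prime a hb0 hσ (S.sup id + Int.gcd a b)
    have hg : 0 < Int.gcd a b := Int.gcd_pos_of_ne_zero_right _ hb0
    have hdet : (border A v (2 * (c₀ + M * k))).det = (ε * A.det.sign) * (Int.gcd a b * q) := by
      rw [det_border _ _ _ hAdet, ← hk]; ring
    have hunit : IsUnit (ε * A.det.sign) := IsUnit.of_mul_eq_one _ hσ
    refine ⟨border A v (2 * (c₀ + M * k)), border_transpose _ _ _ hA, ?_, ?_, ?_, ?_, ?_⟩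
    · intro i
      refine Fin.lastCases ?_ (fun i => ?_) i
      · simp
      · simpa using hAev i
    · intro i j
      refine Fin.lastCases ?_ (fun i => ?_) i <;> refine Fin.lastCases ?_ (fun j => ?_) j
      · rw [border_last_last, hc₀]
        exact ⟨2 * k, by ring⟩
      · rw [border_last_castSucc, ← hA₀s]
        exact hvM j
      · rw [border_castSucc_last]
        exact hvM i
      · rw [border_castSucc_castSucc]
        exact hAM i j
    · rw [hdet]
      exact mul_ne_zero hunit.ne_zero (mul_ne_zero (by exact_mod_cast hg.ne')
        (by exact_mod_cast hq.ne_zero))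
    · refine ⟨q, hq, fun h => ?_, fun p hp hpS hpd => ?_, fun h => ?_⟩
      · have : q ≤ S.sup id := Finset.le_sup (f := id) h
        omega
      · rw [hdet, hunit.dvd_mul_left] at hpd
        have hpd' : p ∣ Int.gcd a b * q := by exact_mod_cast hpd
        rcases (hp.dvd_mul).1 hpd' with h | h
        -- A prime outside `S` dividing the gcd divides `b`, hence `det A`, so it is `l`; since it
        -- divides `a` too, it divides `vᵀ adj(A) v`, against the choice of `v`.
        · exfalso
          have hpa : (p : ℤ) ∣ a := (Int.natCast_dvd_natCast.2 h).trans (Int.gcd_dvd_left ..)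
          have hpb : (p : ℤ) ∣ b := (Int.natCast_dvd_natCast.2 h).trans (Int.gcd_dvd_right ..)
          have hpZ : Prime (p : ℤ) := Nat.prime_iff_prime_int.1 hp
          have hpA : (p : ℤ) ∣ A.det := by
            rcases hpZ.dvd_or_dvd hpb with h1 | h1
            · exfalso
              rcases hpZ.dvd_or_dvd h1 with h1 | h1
              · have : p ∣ 2 := by exact_mod_cast h1
                exact hpS (by rwa [(Nat.prime_dvd_prime_iff_eq hp Nat.prime_two).1 this])
              · exact hpS (hM p hp (by exact_mod_cast h1))
            · exact h1
          have hpl := hlA p hp hpS hpA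
          subst hpl
          refine hvl hpA ?_
          have := (hpA.mul_left (2 * c₀)).sub hpa
          rwa [ha, sub_sub_cancel] at this
        · exact (Nat.prime_dvd_prime_iff_eq hp hq).1 h
      · rw [hdet, hunit.dvd_mul_left, pow_two] at h
        have h' : q * q ∣ Int.gcd a b * q := by exact_mod_cast h
        have := Nat.le_of_dvd hg (Nat.dvd_of_mul_dvd_mul_right hq.pos h')
        omega
    · rw [hw]
      have hmap : (border A v (2 * (c₀ + M * k))).map (Int.castRingHom ℝ) =
          border (A.map (Int.castRingHom ℝ)) (fun i => (v i : ℝ)) (2 * (c₀ + M * k) : ℤ) := by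
        ext i j
        refine Fin.lastCases ?_ (fun i => ?_) i <;> refine Fin.lastCases ?_ (fun j => ?_) j <;> simp
      have hdA : (A.map (Int.castRingHom ℝ)).det = A.det :=
        ((Int.castRingHom ℝ).map_det A).symm
      have hdB : (border (A.map (Int.castRingHom ℝ)) (fun i => (v i : ℝ))
          (2 * (c₀ + M * k) : ℤ)).det = ((ε * A.det.sign) * (Int.gcd a b * q) : ℤ) := by
        rw [← hmap, ← hdet]
        exact ((Int.castRingHom ℝ).map_det _).symm
      rw [hmap]
      refine border_eq_congruent hQ hAQ (by rw [hdA]; exact_mod_cast hAdet) _ _ ?_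
      rw [hdA, hdB]
      have hε' : (ε : ℝ) * ε = 1 := by exact_mod_cast hε
      have hgq : (0 : ℝ) < Int.gcd a b * q := by
        have := hq.pos
        positivity
      have hsd := sign_div_self_pos hAdet
      have : (2 * ε : ℝ) * (((ε * A.det.sign) * (Int.gcd a b * q) : ℤ) / (A.det : ℝ)) =
          (ε * ε) * 2 * (Int.gcd a b * q) * (A.det.sign / (A.det : ℝ)) := by
        push_cast; ring
      rw [this, hε']
      positivity

end Dirichlet

end IntegralForms

namespace IntegralForms

/-! ### Hilbert symbols and reciprocity -/

section HilbertSymbol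

open ZMod NumberTheorySymbols

/-- The sign `(-1) ^ (ε(u) ε(w))` for odd residues modulo `8`, where `ε(u) = (u - 1) / 2`. -/
def oddSign (u w : ZMod 8) : ℤ := if (u = 3 ∨ u = 7) ∧ (w = 3 ∨ w = 7) then -1 else 1

/-- The Hilbert symbol of `p ^ i * u` and `p ^ j * w` at `p`, for `u` and `w` prime to `p`. -/
def hilbertOfDecomp (p i : ℕ) (u : ℤ) (j : ℕ) (w : ℤ) : ℤ :=
  if p = 2 then oddSign u w * χ₈ u ^ j * χ₈ w ^ i
  else J(-1 | p) ^ (i * j) * J(u | p) ^ j * J(w | p) ^ i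

/-- The Hilbert symbol of two nonzero integers at a prime `p`. -/
def hilbert (p : ℕ) (a b : ℤ) : ℤ :=
  hilbertOfDecomp p (padicValInt p a) (a / p ^ padicValInt p a)
    (padicValInt p b) (b / p ^ padicValInt p b)

theorem exists_eq_pow_mul {p : ℕ} (hp : p.Prime) {a : ℤ} (ha : a ≠ 0) :
    ∃ (i : ℕ) (u : ℤ), ¬ (p : ℤ) ∣ u ∧ a = (p : ℤ) ^ i * u := by
  obtain ⟨u, h, hu⟩ := (FiniteMultiplicity.of_prime_left
    (Nat.prime_iff_prime_int.1 hp) ha).exists_eq_pow_mul_and_not_dvd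
  exact ⟨_, u, hu, h⟩

theorem padicValInt_pow_mul {p : ℕ} (hp : p.Prime) {i : ℕ} {u : ℤ} (hu : ¬ (p : ℤ) ∣ u) :
    padicValInt p ((p : ℤ) ^ i * u) = i := by
  have := Fact.mk hp
  have hu0 : u ≠ 0 := by rintro rfl; simp at hu
  rw [padicValInt, Int.natAbs_mul, Int.natAbs_pow, Int.natAbs_natCast,
    padicValNat.mul (pow_ne_zero _ hp.ne_zero) (Int.natAbs_ne_zero.2 hu0), padicValNat.prime_pow,
    padicValNat.eq_zero_of_not_dvd (by rwa [← Int.natCast_dvd]), add_zero]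

theorem hilbert_eq {p : ℕ} (hp : p.Prime) {i j : ℕ} {u w : ℤ} (hu : ¬ (p : ℤ) ∣ u)
    (hw : ¬ (p : ℤ) ∣ w) :
    hilbert p ((p : ℤ) ^ i * u) ((p : ℤ) ^ j * w) = hilbertOfDecomp p i u j w := by
  have hp0 : (p : ℤ) ≠ 0 := by exact_mod_cast hp.ne_zero
  rw [hilbert, padicValInt_pow_mul hp hu, padicValInt_pow_mul hp hw,
    Int.mul_ediv_cancel_left _ (pow_ne_zero _ hp0), Int.mul_ediv_cancel_left _ (pow_ne_zero _ hp0)]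

theorem oddSign_comm (u w : ZMod 8) : oddSign u w = oddSign w u := by
  simp only [oddSign, and_comm]

theorem hilbertOfDecomp_comm (p i : ℕ) (u : ℤ) (j : ℕ) (w : ℤ) :
    hilbertOfDecomp p i u j w = hilbertOfDecomp p j w i u := by
  unfold hilbertOfDecomp
  rw [oddSign_comm, mul_comm i j]
  split_ifs <;> ring

theorem hilbert_comm (p : ℕ) (a b : ℤ) : hilbert p a b = hilbert p b a :=
  hilbertOfDecomp_comm _ _ _ _ _

theorem odd_cast_zmod_eight {u : ℤ} (hu : ¬ (2 : ℤ) ∣ u) :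
    (u : ZMod 8) = 1 ∨ (u : ZMod 8) = 3 ∨ (u : ZMod 8) = 5 ∨ (u : ZMod 8) = 7 := by
  have h : u % 8 = 1 ∨ u % 8 = 3 ∨ u % 8 = 5 ∨ u % 8 = 7 := by omega
  rw [← ZMod.intCast_mod u 8]
  rcases h with h | h | h | h <;> simp [h]

theorem oddSign_mul_left : ∀ u v w : ZMod 8, (u = 1 ∨ u = 3 ∨ u = 5 ∨ u = 7) →
    (v = 1 ∨ v = 3 ∨ v = 5 ∨ v = 7) → oddSign (u * v) w = oddSign u w * oddSign v w := by
  decide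

theorem hilbert_mul_left {p : ℕ} (hp : p.Prime) {a a' b : ℤ} (ha : a ≠ 0) (ha' : a' ≠ 0)
    (hb : b ≠ 0) : hilbert p (a * a') b = hilbert p a b * hilbert p a' b := by
  obtain ⟨i, u, hu, rfl⟩ := exists_eq_pow_mul hp ha
  obtain ⟨i', u', hu', rfl⟩ := exists_eq_pow_mul hp ha'
  obtain ⟨j, w, hw, rfl⟩ := exists_eq_pow_mul hp hb
  have huu : ¬ (p : ℤ) ∣ u * u' := fun h =>
    ((Nat.prime_iff_prime_int.1 hp).dvd_or_dvd h).elim hu hu'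
  have : (p : ℤ) ^ i * u * ((p : ℤ) ^ i' * u') = (p : ℤ) ^ (i + i') * (u * u') := by ring
  rw [this, hilbert_eq hp huu hw, hilbert_eq hp hu hw, hilbert_eq hp hu' hw]
  unfold hilbertOfDecomp
  split_ifs with h2
  · subst h2
    rw [Int.cast_mul, oddSign_mul_left _ _ _ (odd_cast_zmod_eight hu) (odd_cast_zmod_eight hu'),
      map_mul, mul_pow, pow_add]
    ring
  · rw [jacobiSym.mul_left, mul_pow, pow_add, add_mul, pow_add]
    ring

theorem hilbert_mul_right {p : ℕ} (hp : p.Prime) {a b b' : ℤ} (ha : a ≠ 0) (hb : b ≠ 0)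
    (hb' : b' ≠ 0) : hilbert p a (b * b') = hilbert p a b * hilbert p a b' := by
  rw [hilbert_comm, hilbert_mul_left hp hb hb' ha, hilbert_comm, hilbert_comm p b']

theorem jacobiSym_eq_one_or_neg_one {p : ℕ} (hp : p.Prime) {u : ℤ} (hu : ¬ (p : ℤ) ∣ u) :
    J(u | p) = 1 ∨ J(u | p) = -1 :=
  jacobiSym.eq_one_or_neg_one (by
    rw [Int.gcd_comm, ← Int.isCoprime_iff_gcd_eq_one]
    exact (Nat.prime_iff_prime_int.1 hp).coprime_iff_not_dvd.2 hu)

theorem chi_eight_eq_one_or_neg_one {u : ℤ} (hu : ¬ (2 : ℤ) ∣ u) : χ₈ u = 1 ∨ χ₈ u = -1 := by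
  rcases odd_cast_zmod_eight hu with h | h | h | h <;> rw [h] <;> decide

theorem hilbert_eq_one_or_neg_one {p : ℕ} (hp : p.Prime) {a b : ℤ} (ha : a ≠ 0) (hb : b ≠ 0) :
    hilbert p a b = 1 ∨ hilbert p a b = -1 := by
  have pow1 : ∀ {x : ℤ} (n : ℕ), (x = 1 ∨ x = -1) → (x ^ n = 1 ∨ x ^ n = -1) := by
    rintro x n (rfl | rfl)
    · simp
    · exact neg_one_pow_eq_or ℤ n
  have mul1 : ∀ {x y : ℤ}, (x = 1 ∨ x = -1) → (y = 1 ∨ y = -1) → (x * y = 1 ∨ x * y = -1) := by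
    rintro x y (rfl | rfl) (rfl | rfl) <;> simp
  obtain ⟨i, u, hu, rfl⟩ := exists_eq_pow_mul hp ha
  obtain ⟨j, w, hw, rfl⟩ := exists_eq_pow_mul hp hb
  rw [hilbert_eq hp hu hw]
  unfold hilbertOfDecomp
  split_ifs with h2
  · subst h2
    refine mul1 (mul1 ?_ (pow1 _ (chi_eight_eq_one_or_neg_one hu)))
      (pow1 _ (chi_eight_eq_one_or_neg_one hw))
    unfold oddSign
    split_ifs <;> simp
  · refine mul1 (mul1 (pow1 _ (jacobiSym_eq_one_or_neg_one hp fun h => hp.one_lt.ne' ?_))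
      (pow1 _ (jacobiSym_eq_one_or_neg_one hp hu))) (pow1 _ (jacobiSym_eq_one_or_neg_one hp hw))
    rw [dvd_neg] at h
    exact Nat.dvd_one.1 (by exact_mod_cast h)

theorem hilbert_eq_one_of_not_dvd {p : ℕ} (hp : p.Prime) (h2 : p ≠ 2) {a b : ℤ}
    (ha : ¬ (p : ℤ) ∣ a) (hb : ¬ (p : ℤ) ∣ b) : hilbert p a b = 1 := by
  have := hilbert_eq hp (i := 0) (j := 0) ha hb
  rw [pow_zero, one_mul, one_mul] at this
  rw [this, hilbertOfDecomp, if_neg h2]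
  simp

/-- The Hilbert symbol at the real place. -/
def hilbertReal (a b : ℤ) : ℤ := if a < 0 ∧ b < 0 then -1 else 1

theorem hilbertReal_comm (a b : ℤ) : hilbertReal a b = hilbertReal b a := by
  simp only [hilbertReal, and_comm]

theorem hilbertReal_mul_left {a a' b : ℤ} (ha : a ≠ 0) (ha' : a' ≠ 0) :
    hilbertReal (a * a') b = hilbertReal a b * hilbertReal a' b := by
  unfold hilbertReal
  rcases lt_or_gt_of_ne ha with h | h <;> rcases lt_or_gt_of_ne ha' with h' | h' <;>
    by_cases hb : b < 0
  · simp [h, h', hb, (mul_pos_of_neg_of_neg h h').le]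
  · simp [hb]
  · simp [h, hb, h'.le, mul_neg_of_neg_of_pos h h']
  · simp [hb]
  · simp [h', hb, h.le, mul_neg_of_pos_of_neg h h']
  · simp [hb]
  · simp [h.not_gt, h'.not_gt, (mul_pos h h').not_gt]
  · simp [hb]

/-- Multiplicative functions are determined by their values at `-1` and at primes; the value at 1
comes from `1 = (-1)(-1)`. -/
theorem eq_of_multiplicative {f g : ℤ → ℤ} (hf : ∀ a b, a ≠ 0 → b ≠ 0 → f (a * b) = f a * f b)
    (hg : ∀ a b, a ≠ 0 → b ≠ 0 → g (a * b) = g a * g b) (h1 : f (-1) = g (-1)) {P : Finset ℕ}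
    (hP : ∀ p ∈ P, f p = g p) {a : ℤ} (ha : a ≠ 0)
    (haP : ∀ p : ℕ, p.Prime → (p : ℤ) ∣ a → p ∈ P) : f a = g a := by
  have hnat : ∀ n : ℕ, n ≠ 0 → (∀ p : ℕ, p.Prime → p ∣ n → p ∈ P) → f n = g n := by
    intro n
    induction n using induction_on_primes with
    | zero => simp
    | one =>
      intro _ _
      have e : ((1 : ℕ) : ℤ) = -1 * -1 := by norm_num
      rw [e, hf _ _ (by norm_num) (by norm_num), hg _ _ (by norm_num) (by norm_num), h1]
    | prime_mul p n hp ih =>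
      intro hn hpn
      have hn0 : n ≠ 0 := right_ne_zero_of_mul hn
      have hp0 : (p : ℤ) ≠ 0 := by exact_mod_cast hp.ne_zero
      rw [Nat.cast_mul, hf _ _ hp0 (by exact_mod_cast hn0), hg _ _ hp0 (by exact_mod_cast hn0),
        hP p (hpn p hp (dvd_mul_right _ _)), ih hn0 fun q hq h => hpn q hq (h.mul_left _)]
  have hna : a.natAbs ≠ 0 := Int.natAbs_ne_zero.2 ha
  have key := hnat a.natAbs hna fun p hp h => haP p hp (Int.natCast_dvd.2 h)
  rcases Int.natAbs_eq a with h | h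
  · rw [h]; exact key
  · have e : -(a.natAbs : ℤ) = -1 * a.natAbs := by ring
    have h0 : (a.natAbs : ℤ) ≠ 0 := by exact_mod_cast hna
    rw [h, e, hf _ _ (by norm_num) h0, hg _ _ (by norm_num) h0, h1, key]

theorem hilbert_two_unit {u w : ℤ} (hu : ¬ (2 : ℤ) ∣ u) (hw : ¬ (2 : ℤ) ∣ w) :
    hilbert 2 u w = oddSign u w := by
  have := hilbert_eq Nat.prime_two (i := 0) (j := 0) hu hw
  rw [pow_zero, one_mul, one_mul] at this
  rw [this, hilbertOfDecomp, if_pos rfl]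
  simp

theorem hilbert_two_two {u : ℤ} (hu : ¬ (2 : ℤ) ∣ u) : hilbert 2 u 2 = χ₈ u := by
  have := hilbert_eq Nat.prime_two (i := 0) (j := 1) hu (w := 1) (by norm_num)
  simp only [pow_zero, one_mul, pow_one, mul_one, Nat.cast_ofNat] at this
  rw [this, hilbertOfDecomp, if_pos rfl]
  have : oddSign u ((1 : ℤ) : ZMod 8) = 1 := by
    rw [oddSign, if_neg]
    rintro ⟨-, h⟩
    revert h
    decide
  rw [this]
  simp

theorem hilbert_prime {l : ℕ} (hl : l.Prime) (h2 : l ≠ 2) {u : ℤ} (hu : ¬ (l : ℤ) ∣ u) :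
    hilbert l u l = J(u | l) := by
  have := hilbert_eq hl (i := 0) (j := 1) hu (w := 1) (fun h => hl.one_lt.ne'
    (Nat.dvd_one.1 (by exact_mod_cast h)))
  simp only [pow_zero, one_mul, pow_one, mul_one] at this
  rw [this, hilbertOfDecomp, if_neg h2]
  simp

theorem hilbert_prime_self {l : ℕ} (hl : l.Prime) (h2 : l ≠ 2) :
    hilbert l l l = J(-1 | l) := by
  have h1 : ¬ (l : ℤ) ∣ 1 := fun h => hl.one_lt.ne' (Nat.dvd_one.1 (by exact_mod_cast h))
  have := hilbert_eq hl (i := 1) (j := 1) (u := 1) (w := 1) h1 h1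
  simp only [pow_one, mul_one] at this
  rw [this, hilbertOfDecomp, if_neg h2]
  simp

theorem hilbert_two_self : hilbert 2 2 2 = 1 := by
  have := hilbert_eq Nat.prime_two (i := 1) (j := 1) (u := 1) (w := 1) (by norm_num) (by norm_num)
  simp only [pow_one, mul_one, Nat.cast_ofNat] at this
  rw [this]
  decide

theorem oddSign_intCast (u w : ℤ) :
    oddSign u w = if u % 4 = 3 ∧ w % 4 = 3 then -1 else 1 := by
  have h : ∀ u : ℤ, ((u : ZMod 8) = 3 ∨ (u : ZMod 8) = 7) ↔ u % 4 = 3 := by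
    intro u
    have h3 : (u : ZMod 8) = 3 ↔ u % 8 = 3 % 8 := by
      have := ZMod.intCast_eq_intCast_iff' u 3 8
      simpa using this
    have h7 : (u : ZMod 8) = 7 ↔ u % 8 = 7 % 8 := by
      have := ZMod.intCast_eq_intCast_iff' u 7 8
      simpa using this
    rw [h3, h7]
    omega
  simp only [oddSign, h]

theorem oddSign_neg_one {l : ℕ} (hl : Odd l) : oddSign (-1 : ℤ) (l : ℤ) = χ₄ l := by
  rw [oddSign_intCast, χ₄_nat_eq_if_mod_four]
  have := Nat.odd_iff.1 hl
  have h4 : l % 4 = 1 ∨ l % 4 = 3 := by omega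
  rcases h4 with h4 | h4
  · rw [if_neg (by omega), if_neg (by omega), if_pos h4]
  · rw [if_pos (by omega), if_neg (by omega), if_neg (by omega)]

theorem oddSign_natCast {l m : ℕ} (hl : Odd l) (hm : Odd m) :
    oddSign (l : ℤ) (m : ℤ) = qrSign l m := by
  have hl' := Nat.odd_iff.1 hl
  have hm' := Nat.odd_iff.1 hm
  rw [oddSign_intCast, qrSign.neg_one_pow hl hm, pow_mul, ← χ₄_eq_neg_one_pow hl']
  have h4 : l % 4 = 1 ∨ l % 4 = 3 := by omega
  rcases h4 with h4 | h4
  · rw [if_neg (by omega), χ₄_nat_one_mod_four h4, one_pow]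
  · rw [χ₄_nat_three_mod_four h4, ← χ₄_eq_neg_one_pow hm', χ₄_nat_eq_if_mod_four]
    have h4' : m % 4 = 1 ∨ m % 4 = 3 := by omega
    rcases h4' with h4' | h4'
    · rw [if_neg (by omega), if_neg (by omega), if_pos h4']
    · rw [if_pos (by omega), if_neg (by omega), if_neg (by omega)]

theorem not_dvd_of_prime_ne {p l : ℕ} (hp : p.Prime) (hl : l.Prime) (h : p ≠ l) :
    ¬ (p : ℤ) ∣ l := fun hd =>
  h ((Nat.prime_dvd_prime_iff_eq hp hl).1 (by exact_mod_cast hd))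

theorem not_dvd_neg_one {p : ℕ} (hp : p.Prime) : ¬ (p : ℤ) ∣ -1 := fun h =>
  hp.one_lt.ne' (Nat.dvd_one.1 (by exact_mod_cast (dvd_neg.1 h)))

theorem prod_hilbert_neg_one_neg_one {P : Finset ℕ} (hP : ∀ p ∈ P, p.Prime) (h2 : 2 ∈ P) :
    ∏ p ∈ P, hilbert p (-1) (-1) = -1 := by
  rw [Finset.prod_eq_single_of_mem 2 h2 fun p hp hp2 =>
    hilbert_eq_one_of_not_dvd (hP p hp) hp2 (not_dvd_neg_one (hP p hp)) (not_dvd_neg_one (hP p hp)),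
    hilbert_two_unit (by norm_num) (by norm_num), oddSign_intCast]
  norm_num

/-- For odd `l` the factors at 2 and at `l` both equal `(-1 | l)`: the first supplementary law. -/
theorem prod_hilbert_neg_one_prime {P : Finset ℕ} (hP : ∀ p ∈ P, p.Prime) (h2 : 2 ∈ P) {l : ℕ}
    (hl : l ∈ P) : ∏ p ∈ P, hilbert p (-1) l = 1 := by
  rcases eq_or_ne l 2 with rfl | hl2
  · rw [Finset.prod_eq_single_of_mem 2 h2 fun p hp hp2 =>
      hilbert_eq_one_of_not_dvd (hP p hp) hp2 (not_dvd_neg_one (hP p hp))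
        (not_dvd_of_prime_ne (hP p hp) Nat.prime_two hp2)]
    have := hilbert_two_two (u := -1) (by norm_num)
    rw [Nat.cast_ofNat, this]
    decide
  · have hlo : Odd l := (hP l hl).odd_of_ne_two hl2
    rw [Finset.prod_eq_mul_of_mem 2 l h2 hl hl2.symm fun p hp h =>
      hilbert_eq_one_of_not_dvd (hP p hp) h.1 (not_dvd_neg_one (hP p hp))
        (not_dvd_of_prime_ne (hP p hp) (hP l hl) h.2),
      hilbert_two_unit (by norm_num) (not_dvd_of_prime_ne Nat.prime_two (hP l hl) hl2.symm),
      hilbert_prime (hP l hl) hl2 (not_dvd_neg_one (hP l hl)), jacobiSym.at_neg_one hlo,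
      oddSign_neg_one hlo, ← jacobiSym.at_neg_one hlo, ← sq]
    exact jacobiSym.sq_one (by simp)

/-- For odd `l` the factors at 2 and at `l` both equal `(2 | l)`: the second supplementary law. -/
theorem prod_hilbert_prime_two {P : Finset ℕ} (hP : ∀ p ∈ P, p.Prime) (h2 : 2 ∈ P) {l : ℕ}
    (hl : l ∈ P) : ∏ p ∈ P, hilbert p l 2 = 1 := by
  have h22 : ∀ p ∈ P, p ≠ 2 → ¬ (p : ℤ) ∣ 2 := fun p hp h => by
    have := not_dvd_of_prime_ne (hP p hp) Nat.prime_two h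
    exact this
  rcases eq_or_ne l 2 with rfl | hl2
  · rw [Nat.cast_ofNat, Finset.prod_eq_single_of_mem 2 h2 fun p hp hp2 =>
      hilbert_eq_one_of_not_dvd (hP p hp) hp2 (h22 p hp hp2) (h22 p hp hp2)]
    exact hilbert_two_self
  · have hlo : Odd l := (hP l hl).odd_of_ne_two hl2
    rw [Finset.prod_eq_mul_of_mem 2 l h2 hl hl2.symm fun p hp h =>
      hilbert_eq_one_of_not_dvd (hP p hp) h.1
        (not_dvd_of_prime_ne (hP p hp) (hP l hl) h.2) (h22 p hp h.1),
      hilbert_two_two (not_dvd_of_prime_ne Nat.prime_two (hP l hl) hl2.symm), hilbert_comm l,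
      hilbert_prime (hP l hl) hl2 (h22 l hl hl2), jacobiSym.at_two hlo, Int.cast_natCast,
      ← jacobiSym.at_two hlo, ← sq]
    refine jacobiSym.sq_one ?_
    rw [Int.gcd_eq_natAbs, Int.natAbs_natCast]
    exact (Nat.coprime_primes Nat.prime_two (hP l hl)).2 hl2.symm

/-- For distinct odd primes only 2, `l` and `m` contribute, and the identity is quadratic
reciprocity. For `l = m` odd it reduces to the value of `(-1 | l)`. -/
theorem prod_hilbert_prime_prime {P : Finset ℕ} (hP : ∀ p ∈ P, p.Prime) (h2 : 2 ∈ P) {l m : ℕ}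
    (hl : l ∈ P) (hm : m ∈ P) : ∏ p ∈ P, hilbert p l m = 1 := by
  rcases eq_or_ne m 2 with rfl | hm2
  · exact prod_hilbert_prime_two hP h2 hl
  rcases eq_or_ne l 2 with rfl | hl2
  · simp only [hilbert_comm _ _ (m : ℤ)]
    exact prod_hilbert_prime_two hP h2 hm
  have hlo : Odd l := (hP l hl).odd_of_ne_two hl2
  have hmo : Odd m := (hP m hm).odd_of_ne_two hm2
  rcases eq_or_ne l m with rfl | hlm
  · rw [Finset.prod_eq_mul_of_mem 2 l h2 hl hl2.symm fun p hp h =>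
      hilbert_eq_one_of_not_dvd (hP p hp) h.1
        (not_dvd_of_prime_ne (hP p hp) (hP l hl) h.2)
        (not_dvd_of_prime_ne (hP p hp) (hP l hl) h.2),
      hilbert_two_unit (not_dvd_of_prime_ne Nat.prime_two (hP l hl) hl2.symm)
        (not_dvd_of_prime_ne Nat.prime_two (hP l hl) hl2.symm),
      hilbert_prime_self (hP l hl) hl2, jacobiSym.at_neg_one hlo]
    have : oddSign (l : ℤ) (l : ℤ) = oddSign (-1 : ℤ) (l : ℤ) := by
      rw [oddSign_intCast, oddSign_intCast]; simp
    rw [this, oddSign_neg_one hlo, ← jacobiSym.at_neg_one hlo, ← sq]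
    exact jacobiSym.sq_one (by simp)
  · have hsub : ({2, l, m} : Finset ℕ) ⊆ P := by
      intro p; simp only [Finset.mem_insert, Finset.mem_singleton]
      rintro (rfl | rfl | rfl) <;> assumption
    rw [← Finset.prod_subset hsub fun p hp h => by
      simp only [Finset.mem_insert, Finset.mem_singleton, not_or] at h
      exact hilbert_eq_one_of_not_dvd (hP p hp) h.1
        (not_dvd_of_prime_ne (hP p hp) (hP l hl) h.2.1)
        (not_dvd_of_prime_ne (hP p hp) (hP m hm) h.2.2)]
    rw [Finset.prod_insert (by simp [hl2.symm, hm2.symm]), Finset.prod_insert (by simp [hlm]),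
      Finset.prod_singleton,
      hilbert_two_unit (not_dvd_of_prime_ne Nat.prime_two (hP l hl) hl2.symm)
        (not_dvd_of_prime_ne Nat.prime_two (hP m hm) hm2.symm), hilbert_comm l,
      hilbert_prime (hP l hl) hl2 (not_dvd_of_prime_ne (hP l hl) (hP m hm) hlm),
      hilbert_prime (hP m hm) hm2 (not_dvd_of_prime_ne (hP m hm) (hP l hl) hlm.symm),
      oddSign_natCast hlo hmo, jacobiSym.quadratic_reciprocity' hlo hmo, qrSign.symm hlo hmo]
    have h1 := qrSign.sq_eq_one hmo hlo
    have h3 : J(m | l) ^ 2 = 1 := jacobiSym.sq_one (by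
      rw [Int.gcd_natCast_natCast]; exact (Nat.coprime_primes (hP m hm) (hP l hl)).2 hlm.symm)
    calc _ = qrSign m l ^ 2 * J(m | l) ^ 2 := by ring
      _ = 1 := by rw [h1, h3, one_mul]

/-- **Hilbert reciprocity**. -/
theorem prod_hilbert {P : Finset ℕ} (hP : ∀ p ∈ P, p.Prime) (h2 : 2 ∈ P) {a b : ℤ} (ha : a ≠ 0)
    (hb : b ≠ 0) (haP : ∀ p : ℕ, p.Prime → (p : ℤ) ∣ a → p ∈ P)
    (hbP : ∀ p : ℕ, p.Prime → (p : ℤ) ∣ b → p ∈ P) :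
    ∏ p ∈ P, hilbert p a b = hilbertReal a b := by
  have mulL : ∀ b : ℤ, b ≠ 0 → ∀ x y : ℤ, x ≠ 0 → y ≠ 0 → ∏ p ∈ P, hilbert p (x * y) b =
      (∏ p ∈ P, hilbert p x b) * ∏ p ∈ P, hilbert p y b := by
    intro b hb x y hx hy
    rw [← Finset.prod_mul_distrib]
    exact Finset.prod_congr rfl fun p hp => hilbert_mul_left (hP p hp) hx hy hb
  have mulR : ∀ b : ℤ, b ≠ 0 → ∀ x y : ℤ, x ≠ 0 → y ≠ 0 → ∏ p ∈ P, hilbert p b (x * y) =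
      (∏ p ∈ P, hilbert p b x) * ∏ p ∈ P, hilbert p b y := by
    intro b hb x y hx hy
    rw [← Finset.prod_mul_distrib]
    exact Finset.prod_congr rfl fun p hp => hilbert_mul_right (hP p hp) hb hx hy
  have mulRealR : ∀ b : ℤ, ∀ x y : ℤ, x ≠ 0 → y ≠ 0 →
      hilbertReal b (x * y) = hilbertReal b x * hilbertReal b y := by
    intro b x y hx hy
    rw [hilbertReal_comm, hilbertReal_mul_left hx hy, hilbertReal_comm, hilbertReal_comm y]
  -- Bimultiplicativity reduces everything to `-1` and primes, one variable at a time. The case of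
  -- `-1` comes first because symmetry reuses it for the pair `(l, -1)`.
  have hneg : ∀ b : ℤ, b ≠ 0 → (∀ p : ℕ, p.Prime → (p : ℤ) ∣ b → p ∈ P) →
      ∏ p ∈ P, hilbert p (-1) b = hilbertReal (-1) b := by
    intro b hb hbP
    refine eq_of_multiplicative (f := fun b => ∏ p ∈ P, hilbert p (-1) b)
      (g := fun b => hilbertReal (-1) b) (mulR _ (by norm_num)) (mulRealR _) ?_ ?_ hb hbP
    · exact prod_hilbert_neg_one_neg_one hP h2
    · intro l hl
      rw [prod_hilbert_neg_one_prime hP h2 hl, hilbertReal, if_neg (by omega)]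
  refine eq_of_multiplicative (f := fun a => ∏ p ∈ P, hilbert p a b)
    (g := fun a => hilbertReal a b) (mulL b hb)
    (fun x y hx hy => hilbertReal_mul_left hx hy) (hneg b hb hbP) (fun l hl => ?_) ha haP
  have hl0 : (l : ℤ) ≠ 0 := by exact_mod_cast (hP l hl).ne_zero
  refine eq_of_multiplicative (f := fun b => ∏ p ∈ P, hilbert p l b)
    (g := fun b => hilbertReal l b) (mulR _ hl0) (mulRealR _) ?_ (fun m hm => ?_) hb hbP
  · simp only [hilbert_comm _ (l : ℤ) (-1), hilbertReal_comm (l : ℤ) (-1)]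
    exact hneg l hl0 fun p hp h => by
      rwa [(Nat.prime_dvd_prime_iff_eq hp (hP l hl)).1 (by exact_mod_cast h)]
  · rw [prod_hilbert_prime_prime hP h2 hl hm, hilbertReal, if_neg (by omega)]

end HilbertSymbol

end IntegralForms

namespace IntegralForms

open Matrix NumberTheorySymbols ZMod

/-! ### The Hilbert symbol decides solvability of conics -/

section Solvability

/-- The conic `a x² + b y² = z²` has a point over the field `K`. -/
def HasConicPoint {K : Type*} [Field K] (a b : K) : Prop :=
  ∃ x y z : K, (x ≠ 0 ∨ y ≠ 0 ∨ z ≠ 0) ∧ a * x ^ 2 + b * y ^ 2 = z ^ 2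

variable {K : Type*} [Field K]

theorem hasConicPoint_comm {a b : K} : HasConicPoint a b ↔ HasConicPoint b a := by
  have : ∀ a b : K, HasConicPoint a b → HasConicPoint b a := fun a b ⟨x, y, z, h, e⟩ =>
    ⟨y, x, z, by tauto, by rw [add_comm, e]⟩
  exact ⟨this a b, this b a⟩

theorem hasConicPoint_sq_mul {a b c : K} (hc : c ≠ 0) :
    HasConicPoint (c ^ 2 * a) b ↔ HasConicPoint a b := by
  constructor
  · rintro ⟨x, y, z, h, e⟩
    exact ⟨c * x, y, z, by simpa [hc] using h, by rw [← e]; ring⟩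
  · rintro ⟨x, y, z, h, e⟩
    exact ⟨c⁻¹ * x, y, z, by simpa [hc] using h, by rw [← e]; field_simp⟩

/-- From `a x² + b y² = z²` follows `a z² - a b y² = (a x)²`. Applying this twice multiplies `b` by
the square `a²`, whence the converse. It reduces two uniformizers to a unit and a uniformizer. -/
theorem hasConicPoint_neg_mul {a b : K} (ha : a ≠ 0) :
    HasConicPoint a (-a * b) ↔ HasConicPoint a b := by
  have h : ∀ b : K, HasConicPoint a b → HasConicPoint a (-a * b) := by
    rintro b ⟨x, y, z, h, e⟩
    exact ⟨z, y, a * x, by simp [ha]; tauto, by rw [← e]; ring⟩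
  refine ⟨fun h' => ?_, h b⟩
  have := h _ h'
  have e : -a * (-a * b) = a ^ 2 * b := by ring
  rwa [e, hasConicPoint_comm, hasConicPoint_sq_mul ha, hasConicPoint_comm] at this

theorem hasConicPoint_of_eq_sq {a b x y c : K} (h : a * x ^ 2 + b * y ^ 2 = c ^ 2) (hx : x ≠ 0) :
    HasConicPoint a b :=
  ⟨x, y, c, Or.inl hx, h⟩

variable {p : ℕ} [Fact p.Prime]

theorem exists_primitive_conicPoint {a b : ℤ} (h : HasConicPoint (a : ℚ_[p]) b) :
    ∃ x y z : ℤ_[p], (x = 1 ∨ y = 1 ∨ z = 1) ∧ (a : ℤ_[p]) * x ^ 2 + b * y ^ 2 = z ^ 2 := by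
  obtain ⟨x, y, z, h0, e⟩ := h
  have hv : ![x, y, z] ≠ 0 := by
    intro hv
    have h1 := congrFun hv 0
    have h2 := congrFun hv 1
    have h3 := congrFun hv 2
    simp at h1 h2 h3
    tauto
  obtain ⟨w, j, -, hwj, -, hw⟩ := exists_primitive hv
  refine ⟨w 0, w 1, w 2, ?_, ?_⟩
  · fin_cases j
    · exact Or.inl hwj
    · exact Or.inr (Or.inl hwj)
    · exact Or.inr (Or.inr hwj)
  · apply Subtype.coe_injective
    have h1 := hw 0
    have h2 := hw 1
    have h3 := hw 2
    push_cast
    rw [h1, h2, h3]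
    simp only [Matrix.cons_val]
    rw [mul_pow _ z, ← e]
    ring

theorem exists_sq_eq {u x : ℤ_[p]} (h : ‖x ^ 2 - u‖ < ‖2 * x‖ ^ 2) : ∃ z : ℤ_[p], z ^ 2 = u := by
  obtain ⟨z, hz, -⟩ := hensels_lemma (p := p) (F := Polynomial.X ^ 2 - Polynomial.C u) (a := x) (by
    have hd : Polynomial.aeval x (Polynomial.derivative
        (Polynomial.X ^ 2 - Polynomial.C u : Polynomial ℤ_[p])) = 2 * x := by simp [one_add_one_eq_two]
    rw [hd]
    simpa using h)
  exact ⟨z, by simpa [sub_eq_zero] using hz⟩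

theorem toZMod_intCast_eq_zero_iff (u : ℤ) :
    PadicInt.toZMod (u : ℤ_[p]) = 0 ↔ (p : ℤ) ∣ u := by
  rw [map_intCast, ZMod.intCast_zmod_eq_zero_iff_dvd]

theorem exists_sq_eq_of_jacobiSym (h2 : p ≠ 2) {u : ℤ} (hu : ¬ (p : ℤ) ∣ u) (hJ : J(u | p) = 1) :
    ∃ c : ℚ_[p], c ^ 2 = u := by
  obtain ⟨r, hr⟩ := ZMod.isSquare_of_jacobiSym_eq_one hJ
  obtain ⟨s, rfl⟩ := ZMod.ringHom_surjective (PadicInt.toZMod (p := p)) r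
  have h1 : (p : ℤ_[p]) ∣ s ^ 2 - u := by
    rw [← toZMod_eq_zero_iff, map_sub, map_pow, map_intCast, hr]; ring
  have hs : ¬ (p : ℤ_[p]) ∣ 2 * s := by
    rw [← toZMod_eq_zero_iff, map_mul, mul_eq_zero, not_or]
    constructor
    · have := (toZMod_intCast_eq_zero_iff (p := p) 2).not.2
        (not_dvd_of_prime_ne Fact.out Nat.prime_two h2)
      simpa using this
    · intro h0
      rw [h0, mul_zero] at hr
      exact hu ((ZMod.intCast_zmod_eq_zero_iff_dvd u p).1 hr)
  obtain ⟨z, hz⟩ := exists_sq_eq (u := (u : ℤ_[p])) (x := s) (by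
    rw [← PadicInt.norm_lt_one_iff_dvd] at h1 hs
    have : ‖2 * s‖ = 1 := le_antisymm (PadicInt.norm_le_one _) (not_lt.1 hs)
    rw [this]; simpa using h1)
  exact ⟨z, by rw [← PadicInt.coe_pow, hz]; simp⟩

/-- Hensel's lemma at `x = 1`: the error has norm at most `1/8`, below `‖2‖² = 1/4`. -/
theorem exists_sq_eq_of_mod_eight {u : ℤ} (h : u % 8 = 1) : ∃ c : ℚ_[2], c ^ 2 = u := by
  obtain ⟨z, hz⟩ := exists_sq_eq (p := 2) (u := (u : ℤ_[2])) (x := 1) (by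
    have h1 : ((1 : ℤ_[2]) ^ 2 - u) = ((1 - u : ℤ) : ℤ_[2]) := by push_cast; ring
    have h2 : ‖((1 - u : ℤ) : ℤ_[2])‖ ≤ ((2 : ℕ) : ℝ) ^ (-(3 : ℕ) : ℤ) := by
      rw [PadicInt.norm_int_le_pow_iff_dvd]
      push_cast
      omega
    have h3 : ‖(2 : ℤ_[2])‖ = (2 : ℝ)⁻¹ := by
      have := PadicInt.norm_p (p := 2)
      simpa using this
    rw [h1, mul_one, h3]
    refine h2.trans_lt ?_
    norm_num)
  exact ⟨z, by rw [← PadicInt.coe_pow, hz]; simp⟩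

/-- The ternary form `u x² + w y² - z²` is unimodular at odd `p`, hence isotropic. -/
theorem hasConicPoint_unit_unit (h2 : p ≠ 2) {u w : ℤ} (hu : ¬ (p : ℤ) ∣ u) (hw : ¬ (p : ℤ) ∣ w) :
    HasConicPoint (u : ℚ_[p]) w := by
  obtain ⟨f, hf⟩ := exists_gram_eq (R := ℤ_[p])
    (A := Matrix.diagonal ![2 * (u : ℤ_[p]), 2 * (w : ℤ_[p]), 2 * (-1)])
    (Matrix.diagonal_transpose _) (fun i => by
      rw [Matrix.diagonal_apply_eq]
      fin_cases i <;> exact dvd_mul_right _ _)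
  obtain ⟨v, hv, h0⟩ := isIsotropic_of_not_dvd_det (f := f) h2 le_rfl (by
    rw [hf, Matrix.det_diagonal, Fin.prod_univ_three, ← toZMod_eq_zero_iff]
    simp only [Matrix.cons_val, map_mul, map_neg, map_one, mul_eq_zero, not_or,
      toZMod_intCast_eq_zero_iff]
    have := (toZMod_intCast_eq_zero_iff (p := p) 2).not.2
        (not_dvd_of_prime_ne Fact.out Nat.prime_two h2)
    rw [Int.cast_ofNat] at this
    exact ⟨⟨⟨this, hu⟩, this, hw⟩, this, by simp⟩)
  have h1 := two_mul_apply f v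
  rw [h0, mul_zero, hf] at h1
  simp only [dotProduct, Fin.sum_univ_three, Matrix.mulVec_diagonal, Matrix.cons_val] at h1
  have h3 : (u : ℤ_[p]) * v 0 ^ 2 + w * v 1 ^ 2 = v 2 ^ 2 := by
    apply mul_left_cancel₀ (two_ne_zero (α := ℤ_[p]))
    linear_combination -h1
  refine ⟨v 0, v 1, v 2, ?_, by exact_mod_cast congrArg (fun z : ℤ_[p] => (z : ℚ_[p])) h3⟩
  by_contra! h
  refine hv (funext fun i => ?_)
  apply Subtype.coe_injective
  fin_cases i
  · exact h.1
  · exact h.2.1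
  · exact h.2.2

theorem hasConicPoint_unit_prime_iff (h2 : p ≠ 2) {u w : ℤ} (hu : ¬ (p : ℤ) ∣ u)
    (hw : ¬ (p : ℤ) ∣ w) : HasConicPoint (u : ℚ_[p]) ((p * w : ℤ) : ℚ_[p]) ↔ J(u | p) = 1 := by
  constructor
  · intro h
    obtain ⟨x, y, z, h1, e⟩ := exists_primitive_conicPoint h
    have e' := congrArg (PadicInt.toZMod (p := p)) e
    simp only [map_add, map_mul, map_pow, map_intCast, Int.cast_mul, Int.cast_natCast,
      map_natCast, ZMod.natCast_self, zero_mul, add_zero] at e'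
    have hu0 : (u : ZMod p) ≠ 0 := by rwa [Ne, ZMod.intCast_zmod_eq_zero_iff_dvd]
    by_cases hx : PadicInt.toZMod x = 0
    -- If `p ∣ x` then `p ∣ z`, and cancelling one `p` gives `p ∣ y`, contradicting primitivity.
    · exfalso
      have hz : PadicInt.toZMod z = 0 := by
        rw [hx] at e'
        exact pow_eq_zero_iff two_ne_zero |>.1 (by rw [← e']; ring)
      obtain ⟨x', rfl⟩ := (toZMod_eq_zero_iff _).1 hx
      obtain ⟨z', rfl⟩ := (toZMod_eq_zero_iff _).1 hz
      have hp0 : (p : ℤ_[p]) ≠ 0 := by exact_mod_cast (Fact.out : p.Prime).ne_zero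
      have e2 : (w : ℤ_[p]) * y ^ 2 = p * (z' ^ 2 - u * x' ^ 2) := by
        apply mul_left_cancel₀ hp0
        push_cast at e
        linear_combination e
      have hy : PadicInt.toZMod y = 0 := by
        have := congrArg (PadicInt.toZMod (p := p)) e2
        simp only [map_mul, map_pow, map_intCast, map_natCast, ZMod.natCast_self, zero_mul,
          mul_eq_zero] at this
        rcases this with h | h
        · exact absurd ((ZMod.intCast_zmod_eq_zero_iff_dvd w p).1 h) hw
        · exact pow_eq_zero_iff two_ne_zero |>.1 h
      rcases h1 with h1 | h1 | h1
      · rw [h1] at hx; simp at hx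
      · rw [h1] at hy; simp at hy
      · rw [h1] at hz; simp at hz
    · have hsq : IsSquare (u : ZMod p) := by
        refine ⟨PadicInt.toZMod z / PadicInt.toZMod x, ?_⟩
        field_simp
        exact e'
      rw [← jacobiSym.legendreSym.to_jacobiSym]
      exact (legendreSym.eq_one_iff p hu0).2 hsq
  · intro h
    obtain ⟨c, hc⟩ := exists_sq_eq_of_jacobiSym h2 hu h
    exact hasConicPoint_of_eq_sq (x := 1) (y := 0) (c := c) (by rw [hc]; ring) one_ne_zero

theorem sq_zmod_eight : ∀ x : ZMod 8, x ^ 2 = 0 ∨ x ^ 2 = 1 ∨ x ^ 2 = 4 := by decide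

/-- The variables returned are the squares of the coordinates modulo 8, which keeps the later case
checks finite and short. -/
theorem exists_primitive_conicPoint_mod_eight {a b : ℤ} (h : HasConicPoint (a : ℚ_[2]) b) :
    ∃ x y z : ZMod 8, (x = 1 ∨ y = 1 ∨ z = 1) ∧ (x = 0 ∨ x = 1 ∨ x = 4) ∧
      (y = 0 ∨ y = 1 ∨ y = 4) ∧ (z = 0 ∨ z = 1 ∨ z = 4) ∧ (a : ZMod 8) * x + b * y = z := by
  obtain ⟨x, y, z, h1, e⟩ := exists_primitive_conicPoint h
  let φ : ℤ_[2] →+* ZMod 8 := PadicInt.toZModPow 3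
  refine ⟨φ x ^ 2, φ y ^ 2, φ z ^ 2, ?_, sq_zmod_eight _, sq_zmod_eight _, sq_zmod_eight _, ?_⟩
  · rcases h1 with rfl | rfl | rfl <;> simp
  · have := congrArg φ e
    simpa only [map_add, map_mul, map_pow, map_intCast] using this

theorem oddSign_eq_one_of_solution : ∀ u w : ZMod 8, (u = 1 ∨ u = 3 ∨ u = 5 ∨ u = 7) →
    (w = 1 ∨ w = 3 ∨ w = 5 ∨ w = 7) → ∀ x y z : ZMod 8, (x = 0 ∨ x = 1 ∨ x = 4) →
    (y = 0 ∨ y = 1 ∨ y = 4) → (z = 0 ∨ z = 1 ∨ z = 4) → (x = 1 ∨ y = 1 ∨ z = 1) →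
    u * x + w * y = z → oddSign u w = 1 := by
  rintro u w (rfl | rfl | rfl | rfl) (rfl | rfl | rfl | rfl) x y z (rfl | rfl | rfl)
    (rfl | rfl | rfl) (rfl | rfl | rfl) <;> decide

theorem oddSign_mul_chi_eq_one_of_solution : ∀ u w : ZMod 8, (u = 1 ∨ u = 3 ∨ u = 5 ∨ u = 7) →
    (w = 1 ∨ w = 3 ∨ w = 5 ∨ w = 7) → ∀ x y z : ZMod 8, (x = 0 ∨ x = 1 ∨ x = 4) →
    (y = 0 ∨ y = 1 ∨ y = 4) → (z = 0 ∨ z = 1 ∨ z = 4) → (x = 1 ∨ y = 1 ∨ z = 1) →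
    u * x + 2 * w * y = z → oddSign u w * χ₈ u = 1 := by
  rintro u w (rfl | rfl | rfl | rfl) (rfl | rfl | rfl | rfl) x y z (rfl | rfl | rfl)
    (rfl | rfl | rfl) (rfl | rfl | rfl) <;> decide

/-- When the symbol is trivial, `(1, 0)` or `(1, 1)` already gives a value congruent to 1 modulo 8,
a 2-adic square. -/
theorem oddSign_mul_chi_eq_one_iff : ∀ u w : ZMod 8, (u = 1 ∨ u = 3 ∨ u = 5 ∨ u = 7) →
    (w = 1 ∨ w = 3 ∨ w = 5 ∨ w = 7) → oddSign u w * χ₈ u = 1 → u = 1 ∨ u + 2 * w = 1 := by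
  decide

theorem intCast_zmod_eight_eq_one_iff (u : ℤ) : (u : ZMod 8) = 1 ↔ u % 8 = 1 := by
  have := ZMod.intCast_eq_intCast_iff' u 1 8
  simpa using this

theorem hasConicPoint_of_mod_eight {a b x y : ℤ} (h : (a * x ^ 2 + b * y ^ 2) % 8 = 1)
    (hx : x ≠ 0) : HasConicPoint (a : ℚ_[2]) b := by
  obtain ⟨c, hc⟩ := exists_sq_eq_of_mod_eight h
  exact hasConicPoint_of_eq_sq (x := (x : ℚ_[2])) (y := y) (c := c)
    (by rw [hc]; push_cast; ring) (by exact_mod_cast hx)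

theorem hasConicPoint_two_unit_unit_iff {u w : ℤ} (hu : ¬ (2 : ℤ) ∣ u) (hw : ¬ (2 : ℤ) ∣ w) :
    HasConicPoint (u : ℚ_[2]) w ↔ oddSign u w = 1 := by
  constructor
  · intro h
    obtain ⟨x, y, z, h1, hx, hy, hz, e⟩ := exists_primitive_conicPoint_mod_eight h
    exact oddSign_eq_one_of_solution _ _ (odd_cast_zmod_eight hu) (odd_cast_zmod_eight hw)
      x y z hx hy hz h1 e
  · have key : ∀ u w : ℤ, ¬ (2 : ℤ) ∣ u → ¬ (2 : ℤ) ∣ w → u % 4 ≠ 3 →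
        HasConicPoint (u : ℚ_[2]) w := by
      intro u w hu hw h
      have : u % 8 = 1 ∨ u % 8 = 5 := by omega
      rcases this with h | h
      · exact hasConicPoint_of_mod_eight (x := 1) (y := 0) (by omega) one_ne_zero
      -- As `w` is odd, `u + 4 w` is congruent to `5 + 4`, that is to 1, modulo 8.
      · exact hasConicPoint_of_mod_eight (x := 1) (y := 2) (by omega) one_ne_zero
    intro h
    rw [oddSign_intCast] at h
    by_cases h3 : u % 4 = 3
    · rw [hasConicPoint_comm]
      refine key w u hw hu fun h4 => ?_
      rw [if_pos ⟨h3, h4⟩] at h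
      norm_num at h
    · exact key u w hu hw h3

theorem hasConicPoint_two_unit_prime_iff {u w : ℤ} (hu : ¬ (2 : ℤ) ∣ u) (hw : ¬ (2 : ℤ) ∣ w) :
    HasConicPoint (u : ℚ_[2]) ((2 * w : ℤ) : ℚ_[2]) ↔ oddSign u w * χ₈ u = 1 := by
  constructor
  · intro h
    obtain ⟨x, y, z, h1, hx, hy, hz, e⟩ := exists_primitive_conicPoint_mod_eight h
    exact oddSign_mul_chi_eq_one_of_solution _ _ (odd_cast_zmod_eight hu) (odd_cast_zmod_eight hw)
      x y z hx hy hz h1 (by simpa using e)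
  · intro h
    rcases oddSign_mul_chi_eq_one_iff _ _ (odd_cast_zmod_eight hu) (odd_cast_zmod_eight hw) h
      with h | h
    · rw [intCast_zmod_eight_eq_one_iff] at h
      exact hasConicPoint_of_mod_eight (x := 1) (y := 0) (by omega) one_ne_zero
    · have : ((u + 2 * w : ℤ) : ZMod 8) = 1 := by push_cast; exact h
      rw [intCast_zmod_eight_eq_one_iff] at this
      exact hasConicPoint_of_mod_eight (x := 1) (y := 1) (by omega) one_ne_zero

/-- The symbol counterpart at 2 of replacing the conic of `(2u, 2w)` by that of `(-uw, 2u)`. -/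
theorem oddSign_neg_mul : ∀ u w : ZMod 8, (u = 1 ∨ u = 3 ∨ u = 5 ∨ u = 7) →
    (w = 1 ∨ w = 3 ∨ w = 5 ∨ w = 7) →
    oddSign (-(u * w)) u * χ₈ (-(u * w)) = oddSign u w * χ₈ u * χ₈ w := by
  decide

theorem hasConicPoint_unit_unit_iff {u w : ℤ} (hu : ¬ (p : ℤ) ∣ u) (hw : ¬ (p : ℤ) ∣ w) :
    HasConicPoint (u : ℚ_[p]) w ↔ hilbertOfDecomp p 0 u 0 w = 1 := by
  rw [hilbertOfDecomp]
  split_ifs with h2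
  · subst h2
    rw [hasConicPoint_two_unit_unit_iff hu hw]
    simp
  · simp [hasConicPoint_unit_unit h2 hu hw]

theorem hasConicPoint_unit_uniformizer_iff {u w : ℤ} (hu : ¬ (p : ℤ) ∣ u) (hw : ¬ (p : ℤ) ∣ w) :
    HasConicPoint (u : ℚ_[p]) ((p * w : ℤ) : ℚ_[p]) ↔ hilbertOfDecomp p 0 u 1 w = 1 := by
  rw [hilbertOfDecomp]
  split_ifs with h2
  · subst h2
    have := hasConicPoint_two_unit_prime_iff hu hw
    rw [Nat.cast_ofNat, this]
    simp
  · rw [hasConicPoint_unit_prime_iff h2 hu hw]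
    simp

theorem hasConicPoint_uniformizer_uniformizer_iff {u w : ℤ} (hu : ¬ (p : ℤ) ∣ u)
    (hw : ¬ (p : ℤ) ∣ w) : HasConicPoint ((p * u : ℤ) : ℚ_[p]) ((p * w : ℤ) : ℚ_[p]) ↔
      hilbertOfDecomp p 1 u 1 w = 1 := by
  have hp : p.Prime := Fact.out
  have hp0 : (p : ℚ_[p]) ≠ 0 := by exact_mod_cast hp.ne_zero
  have hu0 : (u : ℚ_[p]) ≠ 0 := by
    have : u ≠ 0 := by rintro rfl; simp at hu
    exact_mod_cast this
  have huw : ¬ (p : ℤ) ∣ -(u * w) := fun h =>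
    ((Nat.prime_iff_prime_int.1 hp).dvd_or_dvd ((dvd_neg).1 h)).elim hu hw
  have e : -((p * u : ℤ) : ℚ_[p]) * ((p * w : ℤ) : ℚ_[p]) =
      (p : ℚ_[p]) ^ 2 * ((-(u * w) : ℤ) : ℚ_[p]) := by push_cast; ring
  rw [← hasConicPoint_neg_mul (by push_cast; exact mul_ne_zero hp0 hu0), e, hasConicPoint_comm,
    hasConicPoint_sq_mul hp0, hasConicPoint_unit_uniformizer_iff huw hu]
  unfold hilbertOfDecomp
  split_ifs with h2
  · subst h2
    have := oddSign_neg_mul _ _ (odd_cast_zmod_eight hu) (odd_cast_zmod_eight hw)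
    push_cast
    rw [pow_one, pow_zero, mul_one, pow_one, pow_one, this]
  · have : -(u * w) = -1 * u * w := by ring
    rw [this, jacobiSym.mul_left, jacobiSym.mul_left]
    simp

theorem hilbert_sq_mul_left {p : ℕ} (hp : p.Prime) {a b c : ℤ} (ha : a ≠ 0) (hb : b ≠ 0)
    (hc : c ≠ 0) : hilbert p (c ^ 2 * a) b = hilbert p a b := by
  rw [hilbert_mul_left hp (pow_ne_zero _ hc) ha hb, sq, hilbert_mul_left hp hc hc hb]
  rcases hilbert_eq_one_or_neg_one hp hc hb with h | h <;> rw [h] <;> ring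

theorem hasConicPoint_padic_iff {a b : ℤ} (ha : a ≠ 0) (hb : b ≠ 0) :
    HasConicPoint (a : ℚ_[p]) b ↔ hilbert p a b = 1 := by
  have hp : p.Prime := Fact.out
  have hpZ : (p : ℤ) ≠ 0 := by exact_mod_cast hp.ne_zero
  -- Both sides are insensitive to square factors, so each argument may be taken to be a unit or `p`
  -- times a unit.
  have red : ∀ a : ℤ, a ≠ 0 → ∃ (c u : ℤ), c ≠ 0 ∧ ¬ (p : ℤ) ∣ u ∧
      (a = c ^ 2 * u ∨ a = c ^ 2 * (p * u)) := by
    intro a ha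
    obtain ⟨i, u, hu, rfl⟩ := exists_eq_pow_mul hp ha
    rcases Nat.even_or_odd' i with ⟨k, rfl | rfl⟩
    · exact ⟨p ^ k, u, pow_ne_zero _ hpZ, hu, Or.inl (by ring)⟩
    · exact ⟨p ^ k, u, pow_ne_zero _ hpZ, hu, Or.inr (by ring)⟩
  have strip : ∀ a b c : ℤ, a ≠ 0 → b ≠ 0 → c ≠ 0 →
      (HasConicPoint (a : ℚ_[p]) b ↔ hilbert p a b = 1) →
      (HasConicPoint ((c ^ 2 * a : ℤ) : ℚ_[p]) b ↔ hilbert p (c ^ 2 * a) b = 1) := by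
    intro a b c ha hb hc h
    rw [hilbert_sq_mul_left hp ha hb hc, ← h]
    push_cast
    exact hasConicPoint_sq_mul (by exact_mod_cast hc)
  have swap : ∀ a b : ℤ, (HasConicPoint (a : ℚ_[p]) b ↔ hilbert p a b = 1) →
      (HasConicPoint (b : ℚ_[p]) a ↔ hilbert p b a = 1) := by
    intro a b h
    rw [hasConicPoint_comm, hilbert_comm, h]
  have reduce : ∀ a b c d : ℤ, a ≠ 0 → b ≠ 0 → c ≠ 0 → d ≠ 0 →
      (HasConicPoint (a : ℚ_[p]) b ↔ hilbert p a b = 1) →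
      (HasConicPoint ((c ^ 2 * a : ℤ) : ℚ_[p]) ((d ^ 2 * b : ℤ) : ℚ_[p]) ↔
        hilbert p (c ^ 2 * a) (d ^ 2 * b) = 1) := fun a b c d ha hb hc hd h =>
    strip _ _ _ ha (mul_ne_zero (pow_ne_zero _ hd) hb) hc
      (swap _ _ (strip _ _ _ hb ha hd (swap _ _ h)))
  obtain ⟨c, u, hc, hu, hau⟩ := red a ha
  obtain ⟨d, w, hd, hw, hbw⟩ := red b hb
  have hu0 : u ≠ 0 := by rintro rfl; simp at hu
  have hw0 : w ≠ 0 := by rintro rfl; simp at hw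
  have hpu0 : (p : ℤ) * u ≠ 0 := mul_ne_zero hpZ hu0
  have hpw0 : (p : ℤ) * w ≠ 0 := mul_ne_zero hpZ hw0
  have h00 := hilbert_eq hp (i := 0) (j := 0) hu hw
  have h01 := hilbert_eq hp (i := 0) (j := 1) hu hw
  have h10 := hilbert_eq hp (i := 0) (j := 1) hw hu
  have h11 := hilbert_eq hp (i := 1) (j := 1) hu hw
  simp only [pow_zero, pow_one, one_mul] at h00 h01 h10 h11
  rcases hau with rfl | rfl <;> rcases hbw with rfl | rfl
  · exact reduce _ _ _ _ hu0 hw0 hc hd (by rw [h00]; exact hasConicPoint_unit_unit_iff hu hw)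
  · exact reduce _ _ _ _ hu0 hpw0 hc hd
      (by rw [h01]; exact hasConicPoint_unit_uniformizer_iff hu hw)
  · exact reduce _ _ _ _ hpu0 hw0 hc hd
      (swap _ _ (by rw [h10]; exact hasConicPoint_unit_uniformizer_iff hw hu))
  · exact reduce _ _ _ _ hpu0 hpw0 hc hd
      (by rw [h11]; exact hasConicPoint_uniformizer_uniformizer_iff hu hw)

theorem hasConicPoint_real_iff {a b : ℤ} (ha : a ≠ 0) (hb : b ≠ 0) :
    HasConicPoint (a : ℝ) b ↔ hilbertReal a b = 1 := by
  have pos : ∀ a b : ℤ, 0 < a → HasConicPoint (a : ℝ) b := by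
    intro a b h
    have h' : (0 : ℝ) ≤ a := by exact_mod_cast h.le
    exact hasConicPoint_of_eq_sq (x := 1) (y := 0) (c := Real.sqrt a)
      (by rw [Real.sq_sqrt h']; ring) one_ne_zero
  rw [hilbertReal]
  split_ifs with h
  · refine iff_of_false ?_ (by norm_num)
    rintro ⟨x, y, z, h0, e⟩
    have h1 : (a : ℝ) < 0 := by exact_mod_cast h.1
    have h2 : (b : ℝ) < 0 := by exact_mod_cast h.2
    have hx : a * x ^ 2 ≤ 0 := mul_nonpos_of_nonpos_of_nonneg h1.le (sq_nonneg x)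
    have hy : b * y ^ 2 ≤ 0 := mul_nonpos_of_nonpos_of_nonneg h2.le (sq_nonneg y)
    have hz := sq_nonneg z
    have hx0 : a * x ^ 2 = 0 := by linarith
    have hy0 : b * y ^ 2 = 0 := by linarith
    have hz0 : z ^ 2 = 0 := by linarith
    simp [h1.ne, h2.ne] at hx0 hy0 hz0
    tauto
  · refine iff_of_true ?_ rfl
    rw [not_and_or, not_lt, not_lt] at h
    rcases h with h | h
    · exact pos a b (lt_of_le_of_ne h ha.symm)
    · exact hasConicPoint_comm.1 (pos b a (lt_of_le_of_ne h hb.symm))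

end Solvability

end IntegralForms

namespace IntegralForms

open Matrix

/-! ### Ternary forms over `ℤ` and the parity of anisotropic places -/

section Ternary

/-- Diagonalize over `ℚ`, divide by the first coefficient and clear denominators by squares. The
same `a` and `b` serve every field `K`, as needed to compare all places. -/
theorem exists_hasConicPoint_iff {f : QuadraticForm ℤ (Fin 3 → ℤ)} (hf : IsNondegenerate f) :
    ∃ a b : ℤ, a ≠ 0 ∧ b ≠ 0 ∧ ∀ (K : Type) [Field K] [CharZero K],
      IsIsotropic (extend K f) ↔ HasConicPoint (a : K) b := by
  obtain ⟨w, hw⟩ : ∃ w : Fin 3 → ℚ, QuadraticMap.Equivalent (extend ℚ f)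
      (QuadraticMap.weightedSumSquares ℚ w) := by
    have h := QuadraticForm.equivalent_weightedSumSquares (extend ℚ f)
    rwa [Module.finrank_fin_fun] at h
  have hgw : gram (QuadraticMap.weightedSumSquares ℚ w) = diagonal fun i => 2 * w i := by
    refine eq_of_two_mul_dotProduct (Matrix.diagonal_transpose _) fun x => ?_
    simp only [QuadraticMap.weightedSumSquares_apply, dotProduct, Matrix.mulVec_diagonal,
      Finset.mul_sum, smul_eq_mul]
    exact Finset.sum_congr rfl fun i _ => by ring
  have hw0 : ∀ i, w i ≠ 0 := by
    obtain ⟨P, -, hP⟩ := exists_gram_eq_of_equivalent hw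
    have h1 : (gram (extend ℚ f)).det ≠ 0 := by
      rw [gram_extend]
      have := (isNondegenerate_iff f).1 hf
      have h2 : ((gram f).map (algebraMap ℤ ℚ)).det = algebraMap ℤ ℚ (gram f).det :=
        ((algebraMap ℤ ℚ).map_det _).symm
      rw [h2]
      simpa using this
    rw [hP, hgw, Matrix.det_mul, Matrix.det_mul, Matrix.det_diagonal] at h1
    have h3 := Finset.prod_ne_zero_iff.1 (right_ne_zero_of_mul (left_ne_zero_of_mul h1))
    exact fun i => right_ne_zero_of_mul (h3 i (Finset.mem_univ i))
  have key : ∀ (K : Type) [Field K] [CharZero K],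
      IsIsotropic (extend K f) ↔ HasConicPoint ((-w 1 / w 0 : ℚ) : K) ((-w 2 / w 0 : ℚ) : K) := by
    intro K _ _
    rw [← extend_extend ℚ K f]
    have heq := equivalent_extend K hw
    have happ : ∀ x : Fin 3 → K, extend K (QuadraticMap.weightedSumSquares ℚ w) x =
        w 0 * x 0 ^ 2 + w 1 * x 1 ^ 2 + w 2 * x 2 ^ 2 := by
      intro x
      apply mul_left_cancel₀ (two_ne_zero (α := K))
      rw [two_mul_extend_apply, hgw, Matrix.diagonal_map (by simp)]
      simp [dotProduct, Fin.sum_univ_three, Matrix.mulVec_diagonal]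
      ring
    have h0 : (w 0 : K) ≠ 0 := by exact_mod_cast hw0 0
    have e1 : ∀ x y z : K, ((-w 1 / w 0 : ℚ) : K) * x ^ 2 + ((-w 2 / w 0 : ℚ) : K) * y ^ 2 = z ^ 2 ↔
        w 0 * z ^ 2 + w 1 * x ^ 2 + w 2 * y ^ 2 = 0 := by
      intro x y z
      push_cast
      constructor
      · intro h
        rw [← h]; field_simp; ring
      · intro h
        field_simp
        linear_combination -h
    constructor
    · intro h
      obtain ⟨v, hv, hv0⟩ := h.of_equivalent heq
      rw [happ] at hv0
      refine ⟨v 1, v 2, v 0, ?_, (e1 _ _ _).2 hv0⟩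
      by_contra! h
      refine hv (funext fun i => ?_)
      fin_cases i
      · exact h.2.2
      · exact h.1
      · exact h.2.1
    · rintro ⟨x, y, z, h, e⟩
      refine IsIsotropic.of_equivalent heq.symm ⟨![z, x, y], fun hv => ?_, ?_⟩
      · have h1 := congrFun hv 0
        have h2 := congrFun hv 1
        have h3 := congrFun hv 2
        simp at h1 h2 h3
        tauto
      · rw [happ]
        simpa using (e1 x y z).1 e
  have clear : ∀ q : ℚ, q ≠ 0 → ∃ a d : ℤ, a ≠ 0 ∧ d ≠ 0 ∧ (a : ℚ) = d ^ 2 * q := by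
    intro q hq
    refine ⟨q.num * q.den, q.den, mul_ne_zero (Rat.num_ne_zero.2 hq) (by exact_mod_cast q.den_nz),
      by exact_mod_cast q.den_nz, ?_⟩
    have := Rat.mul_den_eq_num q
    push_cast
    linear_combination (-(q.den : ℚ)) * this
  obtain ⟨a, d, ha, hd, had⟩ := clear (-w 1 / w 0) (div_ne_zero (neg_ne_zero.2 (hw0 1)) (hw0 0))
  obtain ⟨b, e, hb, he, hbe⟩ := clear (-w 2 / w 0) (div_ne_zero (neg_ne_zero.2 (hw0 2)) (hw0 0))
  refine ⟨a, b, ha, hb, fun K _ _ => ?_⟩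
  have ha' : (a : K) = (d : K) ^ 2 * ((-w 1 / w 0 : ℚ) : K) := by
    have := congrArg (Rat.cast : ℚ → K) had
    push_cast at this ⊢
    exact this
  have hb' : (b : K) = (e : K) ^ 2 * ((-w 2 / w 0 : ℚ) : K) := by
    have := congrArg (Rat.cast : ℚ → K) hbe
    push_cast at this ⊢
    exact this
  rw [key, ha', hb', hasConicPoint_sq_mul (by exact_mod_cast hd), hasConicPoint_comm,
    ← hasConicPoint_sq_mul (c := (e : K)) (by exact_mod_cast he), hasConicPoint_comm]

/-- If a ternary form is anisotropic at an even number of places, ignoring a prime `q`, then it is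
isotropic at `q`. -/
theorem isIsotropic_of_parity {f : QuadraticForm ℤ (Fin 3 → ℤ)} (hf : IsNondegenerate f)
    {T : Finset ℕ} (hT : ∀ p ∈ T, p.Prime) {q : ℕ} [Fact q.Prime] (hq : q ∉ T)
    (hiso : ∀ (p : ℕ) [Fact p.Prime], p ≠ q → (IsIsotropic (extend ℚ_[p] f) ↔ p ∉ T))
    (hreal : IsIsotropic (extend ℝ f) ↔ Even T.card) : IsIsotropic (extend ℚ_[q] f) := by
  obtain ⟨a, b, ha, hb, hab⟩ := exists_hasConicPoint_iff hf
  let P : Finset ℕ := insert q (insert 2 (T ∪ (a * b).natAbs.primeFactors))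
  have hP : ∀ p ∈ P, p.Prime := by
    intro p hp
    simp only [P, Finset.mem_insert, Finset.mem_union] at hp
    rcases hp with rfl | rfl | hp | hp
    · exact Fact.out
    · exact Nat.prime_two
    · exact hT p hp
    · exact Nat.prime_of_mem_primeFactors hp
  have habP : ∀ p : ℕ, p.Prime → (p : ℤ) ∣ a * b → p ∈ P := by
    intro p hp h
    simp only [P, Finset.mem_insert, Finset.mem_union]
    refine Or.inr (Or.inr (Or.inr ?_))
    rw [Nat.mem_primeFactors]
    exact ⟨hp, Int.natCast_dvd.1 h, Int.natAbs_ne_zero.2 (mul_ne_zero ha hb)⟩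
  have hprod := prod_hilbert hP (by simp [P]) ha hb (fun p hp h => habP p hp (h.mul_right b))
    (fun p hp h => habP p hp (h.mul_left a))
  have hqP : q ∈ P := by simp [P]
  have hTP : T ⊆ P.erase q := by
    intro p hp
    rw [Finset.mem_erase]
    exact ⟨fun h => hq (h ▸ hp), by simp [P, hp]⟩
  have hh : ∀ p ∈ P.erase q, (hilbert p a b = 1 ↔ p ∉ T) := by
    intro p hp
    rw [Finset.mem_erase] at hp
    have := Fact.mk (hP p hp.2)
    rw [← hasConicPoint_padic_iff ha hb, ← hab, hiso p hp.1]
  -- Away from `q` the symbol is `-1` exactly on `T`, so reciprocity reads: symbol at `q` times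
  -- `(-1) ^ #T` equals the real symbol.
  rw [← Finset.mul_prod_erase P _ hqP, ← Finset.prod_subset hTP fun p hp hpT => (hh p hp).2 hpT,
    Finset.prod_congr rfl fun p hp => show hilbert p a b = -1 from
      (hilbert_eq_one_or_neg_one (hT p hp) ha hb).resolve_left
        fun h => (hh p (hTP hp)).1 h hp, Finset.prod_const] at hprod
  have hR : hilbertReal a b = 1 ↔ Even T.card := by
    rw [← hasConicPoint_real_iff ha hb, ← hab, hreal]
  rw [hab, hasConicPoint_padic_iff ha hb]
  by_cases hev : Even T.card
  · rw [hev.neg_one_pow, hR.2 hev, mul_one] at hprod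
    exact hprod
  · have h1 : hilbertReal a b = -1 := by
      have := hR.not.2 hev
      unfold hilbertReal at this ⊢
      split_ifs at this ⊢ with h <;> tauto
    rw [(Nat.not_even_iff_odd.1 hev).neg_one_pow, h1] at hprod
    linarith

end Ternary

/-! ### Signature and real isotropy -/

section RealPlace

variable {n : ℕ}

theorem gram_weightedSumSquares_signs (r : ℕ) : gram (QuadraticMap.weightedSumSquares ℝ
    (fun i : Fin n => if (i : ℕ) < r then (1 : ℝ) else -1)) =
      diagonal fun i : Fin n => if (i : ℕ) < r then (2 : ℝ) else -2 := by
  refine eq_of_two_mul_dotProduct (Matrix.diagonal_transpose _) fun x => ?_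
  simp only [QuadraticMap.weightedSumSquares_apply, dotProduct, Matrix.mulVec_diagonal,
    Finset.mul_sum, smul_eq_mul]
  exact Finset.sum_congr rfl fun i _ => by split_ifs <;> ring

theorem isIsotropic_iff_of_hasSignature {f : QuadraticForm ℝ (Fin n → ℝ)} {r s : ℕ}
    (h : HasSignature f r s) : IsIsotropic f ↔ r * s ≠ 0 := by
  obtain ⟨hrs, he⟩ := h
  constructor
  · intro hf
    obtain ⟨v, hv, h0⟩ := hf.of_equivalent he
    rw [QuadraticMap.weightedSumSquares_apply] at h0
    intro hz
    refine hv ?_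
    have hsum : ∑ i, v i * v i = 0 := by
      rcases mul_eq_zero.1 hz with hr | hs
      · rw [← neg_eq_zero, ← h0, ← Finset.sum_neg_distrib]
        exact Finset.sum_congr rfl fun i _ => by
          rw [if_neg (by omega)]; simp
      · rw [← h0]
        exact Finset.sum_congr rfl fun i _ => by
          rw [if_pos (by omega)]; simp
    rw [Finset.sum_eq_zero_iff_of_nonneg fun i _ => mul_self_nonneg (v i)] at hsum
    ext i
    exact mul_self_eq_zero.1 (hsum i (Finset.mem_univ i))
  · intro hz
    have hr : r ≠ 0 := left_ne_zero_of_mul hz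
    have hs : s ≠ 0 := right_ne_zero_of_mul hz
    let i₀ : Fin n := ⟨0, by omega⟩
    let i₁ : Fin n := ⟨r, by omega⟩
    have hne : i₀ ≠ i₁ := fun h => hr (congrArg Fin.val h).symm
    refine IsIsotropic.of_equivalent he.symm
      ⟨Pi.single i₀ 1 + Pi.single i₁ 1, fun h => ?_, ?_⟩
    · have := congrFun h i₀
      simp [hne] at this
    · rw [QuadraticMap.weightedSumSquares_apply,
        ← Finset.sum_subset (Finset.subset_univ {i₀, i₁}) (fun i _ hi => by
          simp only [Finset.mem_insert, Finset.mem_singleton, not_or] at hi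
          simp [hi.1, hi.2]), Finset.sum_pair hne]
      simp [hne, hne.symm, i₀, i₁, Nat.pos_of_ne_zero hr]

end RealPlace

/-! ### A universal isotropic form over `ℤ_p` -/

section ModelForm

variable {p : ℕ} [Fact p.Prime]

/-- The form `xy + z₁² + z₂² + ⋯`. -/
theorem exists_isotropic_isUniversal {n : ℕ} (hn : 3 ≤ n) :
    ∃ f : QuadraticForm ℤ_[p] (Fin n → ℤ_[p]), IsNondegenerate f ∧ IsIsotropic f ∧
      IsUniversal f ∧ (n = 3 → (gram f).det = -2) := by
  -- The condition `i + j = 1` selects the hyperbolic plane on the first two coordinates; each later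
  -- square contributes a diagonal 2.
  let A : Matrix (Fin n) (Fin n) ℤ_[p] := Matrix.of fun i j =>
    if (i : ℕ) + j = 1 then 1 else if i = j ∧ 2 ≤ (i : ℕ) then 2 else 0
  obtain ⟨f, hf⟩ := exists_gram_eq (A := A) (by
      ext i j
      simp only [A, Matrix.transpose_apply, Matrix.of_apply]
      rw [add_comm]
      by_cases h : i = j
      · subst h; rfl
      · simp [h, Ne.symm h]) (fun i => by
      simp only [A, Matrix.of_apply]
      rw [if_neg (by omega)]
      split_ifs <;> simp)
  let i₀ : Fin n := ⟨0, by omega⟩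
  let i₁ : Fin n := ⟨1, by omega⟩
  have hne : i₀ ≠ i₁ := fun h => by simpa [i₀, i₁] using congrArg Fin.val h
  have h0 : f (Pi.single i₀ 1) = 0 := by
    have := gram_diag f i₀
    rw [hf] at this
    simpa [A, i₀] using this.symm
  have h1 : f (Pi.single i₁ 1) = 0 := by
    have := gram_diag f i₁
    rw [hf] at this
    simpa [A, i₁] using this.symm
  have h01 : QuadraticMap.polar f (Pi.single i₀ 1) (Pi.single i₁ 1) = 1 := by
    change gram f i₀ i₁ = 1
    rw [hf]
    simp [A, i₀, i₁]
  refine ⟨f, ?_, ⟨Pi.single i₀ 1, by simp, h0⟩, fun a _ =>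
    ⟨Pi.single i₀ 1 + a • Pi.single i₁ 1, ?_⟩, ?_⟩
  · rw [isNondegenerate_iff, hf]
    intro hdet
    obtain ⟨v, hv, hAv⟩ := Matrix.exists_mulVec_eq_zero_iff.2 hdet
    refine hv (funext fun i => ?_)
    -- Each row has a single nonzero entry, so a kernel vector vanishes coordinate by coordinate.
    have hrow : ∀ i j : Fin n, (∀ k, k ≠ j → A i k = 0) → A i j * v j = 0 := by
      intro i j h
      have := congrFun hAv i
      rwa [Matrix.mulVec, dotProduct, Finset.sum_eq_single j (fun k _ hk => by rw [h k hk, zero_mul])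
        (by simp)] at this
    by_cases hi : (i : ℕ) ≤ 1
    · have := hrow ⟨1 - i, by omega⟩ i (fun k hk => by
        have hk' : (k : ℕ) ≠ i := fun h => hk (Fin.ext h)
        simp only [A, Matrix.of_apply]
        rw [if_neg (by omega), if_neg (fun h => by have := h.2; omega)])
      simp only [A, Matrix.of_apply] at this
      rw [if_pos (by omega), one_mul] at this
      exact this
    · have := hrow i i (fun k hk => by
        simp only [A, Matrix.of_apply]
        rw [if_neg (by omega), if_neg (fun h => hk h.1.symm)])
      simp only [A, Matrix.of_apply] at this
      rw [if_neg (by omega), if_pos ⟨trivial, by omega⟩] at this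
      simpa using this
  · rw [QuadraticMap.map_add f, QuadraticMap.map_smul, h0, h1, QuadraticMap.polar_smul_right, h01]
    simp
  · rintro rfl
    rw [hf, Matrix.det_fin_three]
    simp [A]

end ModelForm

/-! ### From local forms to a global one -/

section Gluing

theorem exists_forall_dvd_sub {S : Finset ℕ} (hS : ∀ p ∈ S, p.Prime) (N z : ℕ → ℕ) :
    ∃ c : ℤ, ∀ p ∈ S, ((p : ℤ) ^ N p) ∣ c - z p := by
  obtain ⟨k, hk⟩ := Nat.chineseRemainderOfFinset z (fun p => p ^ N p) S
    (fun p hp => pow_ne_zero _ (hS p hp).ne_zero) (fun p hp q hq hpq =>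
      Nat.Coprime.pow _ _ ((Nat.coprime_primes (hS p hp) (hS q hq)).2 hpq))
  refine ⟨k, fun p hp => ?_⟩
  have := (Nat.modEq_iff_dvd.1 (hk p hp).symm)
  push_cast at this
  exact this

theorem exists_forall_dvd_sub_padic {S : Finset ℕ} (hS : ∀ p ∈ S, p.Prime) (N : ℕ → ℕ)
    (x : ∀ (p : ℕ) [Fact p.Prime], ℤ_[p]) :
    ∃ c : ℤ, ∀ (p : ℕ) [Fact p.Prime], p ∈ S → (p : ℤ_[p]) ^ N p ∣ (c : ℤ_[p]) - x p := by
  classical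
  obtain ⟨c, hc⟩ := exists_forall_dvd_sub hS N fun p =>
    if h : p.Prime then haveI := Fact.mk h; (x p).appr (N p) else 0
  refine ⟨c, fun p hp hpS => ?_⟩
  have h1 := hc p hpS
  rw [dif_pos hp.out] at h1
  have h2 := map_dvd (Int.castRingHom ℤ_[p]) h1
  simp only [map_pow, map_sub, eq_intCast, Int.cast_natCast] at h2
  have h3 := Ideal.mem_span_singleton.1 (PadicInt.appr_spec (N p) (x p))
  have : (c : ℤ_[p]) - x p = (c - (x p).appr (N p)) - (x p - (x p).appr (N p)) := by ring
  rw [this]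
  exact h2.sub h3

/-- Integral forms with prescribed completions at the primes of `S` and prescribed signature, whose
discriminant is squarefree with at most one prime factor away from `S`. -/
theorem exists_globalization {n r s : ℕ} (hrs : r + s = n) {S : Finset ℕ}
    (hS : ∀ p ∈ S, p.Prime) (h2 : 2 ∈ S)
    (G : ∀ (p : ℕ) [Fact p.Prime], QuadraticForm ℤ_[p] (Fin n → ℤ_[p]))
    (hG : ∀ (p : ℕ) [Fact p.Prime], p ∈ S → IsNondegenerate (G p)) :
    ∃ f : QuadraticForm ℤ (Fin n → ℤ), IsNondegenerate f ∧
      (∀ (p : ℕ) [Fact p.Prime], p ∈ S → QuadraticMap.Equivalent (extend ℤ_[p] f) (G p)) ∧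
      HasSignature (extend ℝ f) r s ∧
      ∃ l : ℕ, l.Prime ∧ l ∉ S ∧ ∀ (p : ℕ) [Fact p.Prime], p ∉ S →
        ¬ (p : ℤ_[p]) ^ 2 ∣ (gram (extend ℤ_[p] f)).det ∧
        (p ≠ l → ¬ (p : ℤ_[p]) ∣ (gram (extend ℤ_[p] f)).det) := by
  classical
  have hN : ∀ p : ℕ, ∃ N : ℕ, ∀ [Fact p.Prime], p ∈ S →
      ∀ g : QuadraticForm ℤ_[p] (Fin n → ℤ_[p]),
        (∀ i j, (p : ℤ_[p]) ^ N ∣ gram g i j - gram (G p) i j) →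
          QuadraticMap.Equivalent g (G p) := by
    intro p
    by_cases hp : p ∈ S
    · have := Fact.mk (hS p hp)
      obtain ⟨N, hN⟩ := exists_pow_dvd_imp_equivalent (G p) (hG p hp)
      exact ⟨N, fun _ => hN⟩
    · exact ⟨0, fun h => absurd h hp⟩
  choose N hN using hN
  choose d hd using fun i : Fin n =>
    exists_forall_dvd_sub_padic hS N fun p _ => G p (Pi.single i 1)
  choose c hc using fun i j : Fin n =>
    exists_forall_dvd_sub_padic hS N fun p _ => gram (G p) i j
  -- Approximating the values `G p (e_i)` and doubling makes the diagonal even; using only entries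
  -- above the diagonal makes the matrix symmetric.
  let A₀ : Matrix (Fin n) (Fin n) ℤ := Matrix.of fun i j =>
    if i = j then 2 * d i else c (min i j) (max i j)
  have hA₀ : ∀ (p : ℕ) [Fact p.Prime], p ∈ S → ∀ i j,
      (p : ℤ_[p]) ^ N p ∣ (A₀ i j : ℤ_[p]) - gram (G p) i j := by
    intro p _ hp i j
    simp only [A₀, Matrix.of_apply]
    split_ifs with h
    · subst h
      rw [gram_diag]
      push_cast
      rw [← mul_sub]
      exact (hd i p hp).mul_left 2
    · rcases le_total i j with hij | hij
      · rw [min_eq_left hij, max_eq_right hij]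
        exact hc i j p hp
      · rw [min_eq_right hij, max_eq_left hij, ← gram_symm (G p), Matrix.transpose_apply]
        exact hc j i p hp
  obtain ⟨A, hA, hev, hAM, hdet, ⟨l, hl, hlS, hlA, hl2⟩, Q, hQ, hAQ⟩ :=
    exists_approximation h2 (M := ∏ p ∈ S, p ^ N p)
      (Finset.prod_ne_zero_iff.2 fun p hp => pow_ne_zero _ (hS p hp).ne_zero)
      (fun p hp hpM => by
        obtain ⟨q, hq, hpq⟩ := (hp.prime.dvd_finsetProd_iff _).1 hpM
        rwa [(Nat.prime_dvd_prime_iff_eq hp (hS q hq)).1 (hp.dvd_of_dvd_pow hpq)]) A₀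
      (by
        ext i j
        simp only [A₀, Matrix.transpose_apply, Matrix.of_apply, min_comm j i, max_comm j i]
        by_cases h : i = j
        · subst h; rfl
        · rw [if_neg h, if_neg (Ne.symm h)]) (fun i => by simp [A₀]) r s hrs
  obtain ⟨f, hf⟩ := exists_gram_eq hA hev
  have hdetp : ∀ (p : ℕ) [Fact p.Prime], (gram (extend ℤ_[p] f)).det = ((A.det : ℤ) : ℤ_[p]) := by
    intro p _
    rw [gram_extend, hf]
    exact ((algebraMap ℤ ℤ_[p]).map_det A).symm
  have hdvd : ∀ (p : ℕ) [Fact p.Prime] (k : ℕ) (z : ℤ), (p : ℤ_[p]) ^ k ∣ (z : ℤ_[p]) →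
      (p : ℤ) ^ k ∣ z := by
    intro p _ k z h
    rw [← Ideal.mem_span_singleton, ← PadicInt.norm_le_pow_iff_mem_span_pow,
      PadicInt.norm_int_le_pow_iff_dvd] at h
    exact_mod_cast h
  refine ⟨f, ?_, ?_, ⟨hrs, ?_⟩, l, hl, hlS, ?_⟩
  · rw [isNondegenerate_iff, hf]
    exact hdet
  · intro p _ hp
    refine hN p hp _ fun i j => ?_
    have h1 : (gram (extend ℤ_[p] f)) i j = (A i j : ℤ_[p]) := by
      rw [gram_extend, hf]; rfl
    have h2 : (p : ℤ) ^ N p ∣ A i j - A₀ i j := by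
      refine dvd_trans ?_ (hAM i j)
      exact_mod_cast Finset.dvd_prod_of_mem (fun p => p ^ N p) hp
    have h3 := map_dvd (Int.castRingHom ℤ_[p]) h2
    simp only [map_pow, map_sub, eq_intCast, Int.cast_natCast] at h3
    have : (A i j : ℤ_[p]) - gram (G p) i j =
        (A i j - A₀ i j) + (A₀ i j - gram (G p) i j) := by ring
    rw [h1, this]
    exact h3.add (hA₀ p hp i j)
  · refine equivalent_of_gram_eq hQ ?_
    rw [gram_weightedSumSquares_signs, gram_extend, hf]
    exact hAQ
  · intro p hp hpS
    rw [hdetp]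
    have h1 : p ≠ l → ¬ (p : ℤ_[p]) ∣ (A.det : ℤ_[p]) := fun hpl h =>
      hpl (hlA p hp.out hpS (by simpa using hdvd p 1 _ (by simpa using h)))
    refine ⟨fun h => ?_, h1⟩
    by_cases hpl : p = l
    · subst hpl
      exact hl2 (hdvd p 2 _ h)
    · exact h1 hpl ((dvd_pow_self _ two_ne_zero).trans h)

end Gluing

end IntegralForms

/-! ### The globalization theorem -/

open IntegralForms in
/-- Globalization of quadratic forms over `ℤ_p`. -/
theorem theorem5p1 (n r s : ℕ) (hn : 3 ≤ n) (hrs : r + s = n)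
    (S T : Finset ℕ) (hS : ∀ p ∈ S, p.Prime) (hTS : T ⊆ S)
    (hparity : n = 3 → (r * s = 0 → Odd T.card) ∧ (r * s ≠ 0 → Even T.card))
    (F : ∀ (p : ℕ) [Fact p.Prime], p ∈ S → QuadraticForm ℤ_[p] (Fin n → ℤ_[p]))
    (hF : ∀ (p : ℕ) [Fact p.Prime] (hp : p ∈ S), IsNondegenerate (F p hp))
    (hFT : ∀ (p : ℕ) [Fact p.Prime] (hp : p ∈ S), (F p hp).Anisotropic ↔ p ∈ T) :
    ∃ f : QuadraticForm ℤ (Fin n → ℤ),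
      IsNondegenerate f ∧
      (∀ (p : ℕ) [Fact p.Prime] (hp : p ∈ S),
        QuadraticMap.Equivalent (extend ℤ_[p] f) (F p hp)) ∧
      HasSignature (extend ℝ f) r s ∧
      (n = 3 → ∀ (p : ℕ) [Fact p.Prime], p ∉ S →
        IsIsotropic (extend ℤ_[p] f) ∧ IsMaximal ℚ_[p] (extend ℤ_[p] f) ∧
          IsUniversal (extend ℤ_[p] f)) ∧
      (4 ≤ n → ∀ (p : ℕ) [Fact p.Prime], p ∉ S → IsUniversal (extend ℤ_[p] f)) := by
  classical
  choose H hHnd hHiso hHuniv hHdet using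
    fun (p : ℕ) [Fact p.Prime] => exists_isotropic_isUniversal (p := p) hn
  -- The model form fills in at primes outside `S`; it matters only at 2, and being isotropic it
  -- leaves `T` as the set of anisotropic places.
  let G : ∀ (p : ℕ) [Fact p.Prime], QuadraticForm ℤ_[p] (Fin n → ℤ_[p]) := fun p _ =>
    if h : p ∈ S then F p h else H p
  have hGF : ∀ (p : ℕ) [Fact p.Prime] (h : p ∈ S), G p = F p h := fun p _ h => dif_pos h
  have hGH : ∀ (p : ℕ) [Fact p.Prime], p ∉ S → G p = H p := fun p _ h => dif_neg h
  have hGiso : ∀ (p : ℕ) [Fact p.Prime], IsIsotropic (G p) ↔ p ∉ T := by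
    intro p _
    by_cases h : p ∈ S
    · rw [hGF p h, isIsotropic_iff_not_anisotropic, hFT p h]
    · rw [hGH p h]
      exact iff_of_true (hHiso p) fun hT => h (hTS hT)
  obtain ⟨f, hf, hfG, hsig, l, hl, hlS, hdet⟩ := exists_globalization (S := insert 2 S) hrs
    (by simpa [Nat.prime_two] using hS) (Finset.mem_insert_self _ _) G (fun p _ _ => by
      by_cases h : p ∈ S
      · rw [hGF p h]; exact hF p h
      · rw [hGH p h]; exact hHnd p)
  refine ⟨f, hf, fun p _ hp => hGF p hp ▸ hfG p (Finset.mem_insert_of_mem hp), hsig, ?_, ?_⟩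
  · rintro rfl p _ hpS
    have hiso : ∀ (p : ℕ) [Fact p.Prime], p ≠ l → (IsIsotropic (extend ℚ_[p] f) ↔ p ∉ T) := by
      intro p _ hpl
      rw [← extend_extend ℤ_[p] ℚ_[p] f, isIsotropic_extend_padic_iff]
      by_cases hp : p ∈ insert 2 S
      · rw [← hGiso p]
        exact ⟨fun h => h.of_equivalent (hfG p hp), fun h => h.of_equivalent (hfG p hp).symm⟩
      -- Here `p` is odd and differs from `l`, so the form is unimodular at `p`.
      · refine iff_of_true (isIsotropic_of_not_dvd_det ?_ le_rfl ((hdet p hp).2 hpl))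
          fun hT => hp (Finset.mem_insert_of_mem (hTS hT))
        rintro rfl
        exact hp (Finset.mem_insert_self _ _)
    have hpT : p ∉ T := fun h => hpS (hTS h)
    have hiso' : IsIsotropic (extend ℤ_[p] f) := by
      rw [← isIsotropic_extend_padic_iff, extend_extend]
      by_cases hpl : p = l
      · subst hpl
        -- Only `l` is left undecided. The parity hypothesis says exactly that the form is isotropic
        -- over `ℝ` if and only if `#T` is even.
        refine isIsotropic_of_parity hf (fun p hp => hS p (hTS hp)) hpT hiso ?_
        rw [isIsotropic_iff_of_hasSignature hsig]
        refine ⟨(hparity rfl).2, fun hev h0 => ?_⟩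
        exact Nat.not_even_iff_odd.2 ((hparity rfl).1 h0) hev
      · exact (hiso p hpl).2 hpT
    have hdet' : ¬ (p : ℤ_[p]) ^ 2 ∣ (gram (extend ℤ_[p] f)).det := by
      by_cases hp : p ∈ insert 2 S
      -- At 2 outside `S` the determinant is `-2` times the square of a unit, hence not divisible by
      -- 4.
      · obtain rfl : p = 2 := (Finset.mem_insert.1 hp).resolve_right hpS
        obtain ⟨P, hP, hfP⟩ := exists_gram_eq_of_equivalent (hfG 2 hp)
        rw [hfP, hGH 2 hpS, Matrix.det_mul, Matrix.det_mul, Matrix.det_transpose, hHdet 2 rfl,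
          hP.dvd_mul_right, hP.dvd_mul_left, dvd_neg]
        intro h
        have h2 : (2 : ℤ_[2]) ∣ 1 := by
          obtain ⟨c, hc⟩ := h
          refine ⟨c, mul_left_cancel₀ (two_ne_zero (α := ℤ_[2])) ?_⟩
          push_cast at hc
          linear_combination hc
        exact PadicInt.prime_p.not_isUnit (isUnit_of_dvd_one (by exact_mod_cast h2))
      · exact (hdet p hp).1
    exact ⟨hiso', isMaximal_of_not_sq_dvd_det hdet', isUniversal_of_isIsotropic hdet' hiso'⟩
  · intro hn4 p _ hpS
    by_cases hp : p ∈ insert 2 S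
    · have := hfG p hp
      rw [hGH p hpS] at this
      exact (hHuniv p).of_equivalent this.symm
    · refine isUniversal_of_isIsotropic (hdet p hp).1
        (isIsotropic_of_not_sq_dvd_det ?_ hn4 (hdet p hp).1)
      rintro rfl
      exact hp (Finset.mem_insert_self _ _)
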